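/- \textbf{Conventions.} Let $\mathcal M\subset\mathcal B(H)$ be a von Neumann algebra, let $\mathrm{Pr}(\mathcal A)$ denote the set of projections of a von Neumann algebra $\mathcal A$, and put $\mathcal P_{\mathcal M}=\mathrm{Pr}(\mathcal M\bar\otimes\mathcal B(\ell_2))$. A \emph{quantum relation} on $\mathcal M$ is a weak$^*$-closed $\mathcal M'$--$\mathcal M'$ bimodule $\mathcal V\subset\mathcal B(H)$. A \emph{quantum coarse structure} on $\mathcal M$ is a family $\mathscr V$ of quantum relations on $\mathcal M$ which contains $\mathcal M'$, contains every quantum relation on $\mathcal M$ that is included in a member of $\mathscr V$, and is closed under $\mathcal V\mapsto\mathcal V^*$, $(\mathcal V_1,\mathcal V_2)\mapsto\overline{\mathcal V_1+\mathcal V_2}^{w^*}$ and $(\mathcal V_1,\mathcal V_2)\mapsto\overline{\mathrm{span}}^{w^*}(\mathcal V_1\mathcal V_2)$; then $(\mathcal M,\mathscr V)$ is a \emph{quantum coarse space}. Put $\mathcal R_{\mathcal V}=\{(p,q)\in\mathcal P_{\mathcal M}^2:\exists a\in\mathcal V,\ p(a\otimes1)q\neq0\}$ and $\mathscr R_{\mathscr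 V}=\{\mathcal R_{\mathcal V}:\mathcal V\in\mathscr V\}$. An \emph{intrinsic quantum relation} on $\mathcal M$ is a set $\mathcal R\subset\mathcal P_{\mathcal M}^2$, open for the weak operator topology on $\mathcal P_{\mathcal M}$, such that $(0,0)\notin\mathcal R$; for all families of nonzero projections $(p_i)$, $(q_j)$ in $\mathcal P_{\mathcal M}$, $(\bigvee p_i,\bigvee q_j)\in\mathcal R$ if and only if $(p_i,q_j)\in\mathcal R$ for some $i,j$; and $(p,[bq])\in\mathcal R$ if and only if $([b^*p],q)\in\mathcal R$, for all $p,q\in\mathcal P_{\mathcal M}$ and $b\in1\otimes\mathcal B(\ell_2)$, where $[\cdot]$ denotes the range projection. A \emph{quantum function} $\varphi:\mathcal M\to\mathcal N$ is a unital weak$^*$-continuous $^*$-homomorphism of von Neumann algebras. For $\mathcal Q\subset\mathcal P_{\mathcal N}^2$ put $\varphi^*(\mathcal Q)=\{(p,q)\in\mathcal P_{\mathcal M}^2:((\varphi\otimes1)(p),(\varphi\otimes1)(q))\in\mathcal Q\}$. For quantum coarse spaces $(\mathcal M,\mathscr V)$ and $(\mathcal N,\mathscr U)$, $\varphi$ is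 \emph{quantum coarse} if $\varphi^*(\mathcal Q)\in\mathscr R_{\mathscr V}$ for all $\mathcal Q\in\mathscr R_{\mathscr U}$, and \emph{quantum expanding} if every intrinsic quantum relation $\mathcal Q$ on $\mathcal N$ with $\varphi^*(\mathcal Q)\in\mathscr R_{\mathscr V}$ belongs to $\mathscr R_{\mathscr U}$. Quantum functions $\varphi,\psi:\mathcal M\to\mathcal N$ are \emph{quantum close} if there is $\mathcal R\in\mathscr R_{\mathscr V}$ with $(p,q)\in\mathcal R$ for all $p,q\in\mathcal P_{\mathcal M}$ such that $(\varphi\otimes1)(p)\,(\psi\otimes1)(q)\neq0$. The spaces $(\mathcal M,\mathscr V)$ and $(\mathcal N,\mathscr U)$ are \emph{quantum coarsely equivalent} if there are quantum coarse maps $\varphi:\mathcal M\to\mathcal N$ and $\psi:\mathcal N\to\mathcal M$ such that $\psi\circ\varphi$ and $\varphi\circ\psi$ are quantum close to $\mathrm{id}_{\mathcal M}$ and $\mathrm{id}_{\mathcal N}$, respectively. For $p\in\mathrm{Pr}(\mathcal M)$ and $\mathcal R\in\mathscr R_{\mathscr V}$ write $\mathrm{diam}(p)\le\mathcal R$ if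 $(r,s)\in\mathcal R$ for all $r,s\in\mathcal P_{\mathcal M}$ such that $r(pap\otimes1)s\neq0$ for some $a\in\mathcal B(H)$. The space $(\mathcal M,\mathscr V)$ has \emph{asymptotic dimension at most} $n\in\{0,1,2,\dots\}$ if for every $\mathcal R\in\mathscr R_{\mathscr V}$ there are $\mathcal P_0,\dots,\mathcal P_n\subset\mathrm{Pr}(\mathcal M)$ such that the join of all projections in $\bigcup_i\mathcal P_i$ is $1$; for each $i$, $(p\otimes1,q\otimes1)\notin\mathcal R$ for all distinct $p,q\in\mathcal P_i$; and for each $i$ there is $\mathcal R'\in\mathscr R_{\mathscr V}$ with $\mathrm{diam}(p)\le\mathcal R'$ for all $p\in\mathcal P_i$. Let $\mathrm{asydim}(\mathcal M,\mathscr V)\in\{0,1,2,\dots\}\cup\{\infty\}$ be the least such $n$, and $\infty$ if there is none. \textbf{Theorem.} Let $(\mathcal M\subset\mathcal B(H),\mathscr V)$ and $(\mathcal N\subset\mathcal B(K),\mathscr U)$ be quantum coarse spaces. If there is a quantum coarse and quantum expanding quantum function $\varphi:\mathcal M\to\mathcal N$, then $\mathrm{asydim}(\mathcal N,\mathscr U)\le\mathrm{asydim}(\mathcal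 M,\mathscr V)$. In particular, if $(\mathcal M,\mathscr V)$ and $(\mathcal N,\mathscr U)$ are quantum coarsely equivalent, then $\mathrm{asydim}(\mathcal N,\mathscr U)=\mathrm{asydim}(\mathcal M,\mathscr V)$. -/

import Mathlib

open scoped InnerProductSpace Topology

namespace QuantumCoarse

noncomputable section

/-! ### The Hilbert space `H ⊗ ℓ²` and its operators -/

/-- The Hilbert space tensor product `H ⊗ ℓ²`, realised as the space of square-summable sequences
of vectors of `H`. -/
abbrev Ell2 (H : Type*) [NormedAddCommGroup H] : Type _ := lp (fun _ : ℕ => H) 2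

section Operators

variable {H : Type*} [NormedAddCommGroup H] [InnerProductSpace ℂ H]

/-- The embedding `h ↦ h ⊗ δᵢ` of `H` into `H ⊗ ℓ²`. -/
def inj (H : Type*) [NormedAddCommGroup H] [InnerProductSpace ℂ H] (i : ℕ) : H →L[ℂ] Ell2 H :=
  lp.singleContinuousLinearMap ℂ (fun _ : ℕ => H) 2 i

/-- The `i`-th coordinate map `H ⊗ ℓ² → H`. -/
def coord (H : Type*) [NormedAddCommGroup H] [InnerProductSpace ℂ H] (i : ℕ) : Ell2 H →L[ℂ] H :=
  lp.evalCLM ℂ (fun _ : ℕ => H) 2 i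

/-- The `(i, j)` matrix entry of an operator on `H ⊗ ℓ²`. -/
def entry (x : Ell2 H →L[ℂ] Ell2 H) (i j : ℕ) : H →L[ℂ] H :=
  (coord H i).comp (x.comp (inj H j))

theorem memℓp_tensorOne (a : H →L[ℂ] H) (ξ : Ell2 H) : Memℓp (fun n => a (ξ n)) 2 := by
  refine ((lp.memℓp ξ).const_smul (‖a‖ : ℂ)).mono' fun n => ?_
  rw [Pi.smul_apply, norm_smul, Complex.norm_real, norm_norm]
  exact a.le_opNorm (ξ n)

/-- The amplification `a ⊗ 1` of an operator `a` on `H`; it acts coordinatewise. -/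
def tensorOne (a : H →L[ℂ] H) : Ell2 H →L[ℂ] Ell2 H :=
  LinearMap.mkContinuous
    { toFun := fun ξ => ⟨fun n => a (ξ n), memℓp_tensorOne a ξ⟩
      map_add' := fun ξ η => by ext n; exact map_add a (ξ n) (η n)
      map_smul' := fun c ξ => by ext n; exact map_smul a c (ξ n) }
    ‖a‖ (fun ξ => by
      have h : ‖(⟨fun n => a (ξ n), memℓp_tensorOne a ξ⟩ : Ell2 H)‖ ≤ ‖(‖a‖ : ℂ) • ξ‖ :=
        lp.norm_mono (by norm_num) fun n => by
          rw [lp.coeFn_smul, Pi.smul_apply, norm_smul, Complex.norm_real, norm_norm]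
          exact a.le_opNorm (ξ n)
      rwa [norm_smul, Complex.norm_real, norm_norm] at h)

@[simp]
theorem tensorOne_apply (a : H →L[ℂ] H) (ξ : Ell2 H) (n : ℕ) : tensorOne a ξ n = a (ξ n) := rfl

@[simp]
theorem inj_apply (i : ℕ) (h : H) : inj H i h = lp.single 2 i h := rfl

@[simp]
theorem coord_apply (i : ℕ) (ξ : Ell2 H) : coord H i ξ = ξ i := rfl

theorem entry_apply (x : Ell2 H →L[ℂ] Ell2 H) (i j : ℕ) (h : H) :
    entry x i j h = x (lp.single 2 j h) i := rfl

theorem entry_ext {x y : Ell2 H →L[ℂ] Ell2 H} (h : ∀ i j, entry x i j = entry y i j) : x = y := by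
  refine lp.ext_continuousLinearMap (by norm_num) fun j => ?_
  ext v i
  exact congrArg (fun T : H →L[ℂ] H => T v) (h i j)

theorem tensorOne_single (a : H →L[ℂ] H) (j : ℕ) (h : H) :
    tensorOne a (lp.single 2 j h) = lp.single 2 j (a h) := by
  ext i
  by_cases hij : i = j
  · subst hij; simp
  · simp [hij]

theorem entry_tensorOne (a : H →L[ℂ] H) (i j : ℕ) :
    entry (tensorOne a) i j = if i = j then a else 0 := by
  ext v
  rw [entry_apply, tensorOne_single]
  by_cases hij : i = j
  · subst hij; simp
  · simp [hij]

theorem entry_mul_tensorOne (x : Ell2 H →L[ℂ] Ell2 H) (a : H →L[ℂ] H) (i j : ℕ) :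
    entry (x * tensorOne a) i j = entry x i j * a := by
  ext v
  simp [entry_apply, tensorOne_single]

theorem entry_tensorOne_mul (x : Ell2 H →L[ℂ] Ell2 H) (a : H →L[ℂ] H) (i j : ℕ) :
    entry (tensorOne a * x) i j = a * entry x i j := by
  ext v
  simp [entry_apply]

/-- The algebra `1 ⊗ B(ℓ²)`: the operators on `H ⊗ ℓ²` all of whose matrix entries are scalars. -/
def scalarOps (H : Type*) [NormedAddCommGroup H] [InnerProductSpace ℂ H] :
    Set (Ell2 H →L[ℂ] Ell2 H) :=
  {b | ∀ i j, ∃ c : ℂ, entry b i j = c • (1 : H →L[ℂ] H)}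

theorem entry_sub (x y : Ell2 H →L[ℂ] Ell2 H) (i j : ℕ) :
    entry (x - y) i j = entry x i j - entry y i j := by
  ext v; simp [entry_apply]

theorem entry_add (x y : Ell2 H →L[ℂ] Ell2 H) (i j : ℕ) :
    entry (x + y) i j = entry x i j + entry y i j := by
  ext v; simp [entry_apply]

theorem entry_smul (c : ℂ) (x : Ell2 H →L[ℂ] Ell2 H) (i j : ℕ) :
    entry (c • x) i j = c • entry x i j := by
  ext v; simp [entry_apply]

theorem entry_zero (i j : ℕ) : entry (0 : Ell2 H →L[ℂ] Ell2 H) i j = 0 := by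
  ext v; simp [entry_apply]

theorem entry_one (i j : ℕ) :
    entry (1 : Ell2 H →L[ℂ] Ell2 H) i j = if i = j then 1 else 0 := by
  ext v
  by_cases hij : i = j
  · subst hij; simp [entry_apply]
  · simp [entry_apply, hij]

theorem continuous_entry (i j : ℕ) : Continuous fun x : Ell2 H →L[ℂ] Ell2 H => entry x i j := by
  unfold entry
  fun_prop

/-- If the `j`-th column of `z` vanishes from row `n` on, then the `(i, j)` entry of `y z` is given
by a finite matrix product. -/
theorem entry_mul_of_column (y z : Ell2 H →L[ℂ] Ell2 H) (n i j : ℕ)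
    (hz : ∀ k, n ≤ k → entry z k j = 0) :
    entry (y * z) i j = ∑ k ∈ Finset.range n, entry y i k * entry z k j := by
  ext v
  have h1 : z (lp.single 2 j v) = ∑ k ∈ Finset.range n, lp.single 2 k (entry z k j v) := by
    ext m
    rw [lp.coeFn_sum, Finset.sum_apply]
    simp only [lp.single_apply]
    rw [Finset.sum_pi_single]
    split_ifs with hm
    · rfl
    · have := hz m (by simpa using hm)
      rw [← entry_apply, this]; rfl
  rw [entry_apply, mul_apply_eq_comp, h1, map_sum, lp.coeFn_sum, Finset.sum_apply,
    sum_apply]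
  rfl

/-- The operator on `H ⊗ ℓ²` with the given `n × n` block of entries and zeros elsewhere. -/
def ofBlock (n : ℕ) (A : ℕ → ℕ → H →L[ℂ] H) : Ell2 H →L[ℂ] Ell2 H :=
  ∑ i ∈ Finset.range n, ∑ j ∈ Finset.range n, (inj H i).comp ((A i j).comp (coord H j))

theorem entry_ofBlock (n : ℕ) (A : ℕ → ℕ → H →L[ℂ] H) (i j : ℕ) :
    entry (ofBlock n A) i j = if i < n ∧ j < n then A i j else 0 := by
  ext v
  simp only [entry_apply, ofBlock, sum_apply, lp.coeFn_sum, Finset.sum_apply,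
    ContinuousLinearMap.comp_apply, inj_apply, coord_apply, lp.single_apply]
  have : ∀ k ∈ Finset.range n, (∑ l ∈ Finset.range n,
      (Pi.single k (A k l ((Pi.single j v : ℕ → H) l)) : ℕ → H) i) =
      if k = i then (if j < n then A k j v else 0) else 0 := by
    intro k _
    by_cases hk : k = i
    · subst hk
      simp only [Pi.single_eq_same, if_true]
      by_cases hj : j < n
      · rw [Finset.sum_eq_single j]
        · simp [hj]
        · intro b _ hb; simp [hb]
        · intro h; exact absurd (Finset.mem_range.2 hj) h
      · rw [Finset.sum_eq_zero]
        · simp [hj]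
        · intro l hl
          have : l ≠ j := by rintro rfl; exact hj (Finset.mem_range.1 hl)
          simp [this]
    · simp [hk]
  rw [Finset.sum_congr rfl this]
  by_cases hi : i < n <;> by_cases hj : j < n <;> simp [hi, hj]

variable [CompleteSpace H]

theorem entry_star (x : Ell2 H →L[ℂ] Ell2 H) (i j : ℕ) :
    entry (star x) i j = star (entry x j i) := by
  rw [ContinuousLinearMap.star_eq_adjoint, ContinuousLinearMap.star_eq_adjoint,
    ContinuousLinearMap.eq_adjoint_iff]
  intro v w
  have h1 := lp.inner_single_right (𝕜 := ℂ) (G := fun _ : ℕ => H) i w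
    (ContinuousLinearMap.adjoint x (lp.single 2 j v))
  have h2 := lp.inner_single_left (𝕜 := ℂ) (G := fun _ : ℕ => H) j v (x (lp.single 2 i w))
  rw [entry_apply, entry_apply, ← h1, ← h2, ContinuousLinearMap.adjoint_inner_left]

/-- A norm-bounded sequence of operators has a weak operator limit along a nontrivial
ultrafilter. -/
theorem exists_weak_limit (Y : ℕ → H →L[ℂ] H) (C : ℝ) (hY : ∀ n, ‖Y n‖ ≤ C) :
    ∃ T : H →L[ℂ] H, ∀ ξ η : H, Filter.Tendsto (fun n => ⟪Y n ξ, η⟫_ℂ)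
      (Filter.hyperfilter ℕ : Filter ℕ) (𝓝 ⟪T ξ, η⟫_ℂ) := by
  have bd : ∀ n ξ η, ‖⟪Y n ξ, η⟫_ℂ‖ ≤ C * ‖ξ‖ * ‖η‖ := fun n ξ η =>
    (norm_inner_le_norm _ _).trans (by
      gcongr; exact (Y n).le_of_opNorm_le (hY n) ξ)
  have ex : ∀ ξ η : H, ∃ z : ℂ, ‖z‖ ≤ C * ‖ξ‖ * ‖η‖ ∧
      Filter.Tendsto (fun n => ⟪Y n ξ, η⟫_ℂ) (Filter.hyperfilter ℕ : Filter ℕ) (𝓝 z) := by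
    intro ξ η
    obtain ⟨z, hz, h⟩ := (isCompact_closedBall (0 : ℂ) (C * ‖ξ‖ * ‖η‖)).ultrafilter_le_nhds
      ((Filter.hyperfilter ℕ).map fun n => ⟪Y n ξ, η⟫_ℂ) (by
        rw [Ultrafilter.coe_map, Filter.le_principal_iff, Filter.mem_map]
        exact Filter.univ_mem' fun n => by simpa using bd n ξ η)
    exact ⟨z, by simpa using hz, h⟩
  choose B hB1 hB2 using ex
  let B' : H →L⋆[ℂ] H →L[ℂ] ℂ := LinearMap.mkContinuous₂
    (LinearMap.mk₂'ₛₗ (starRingEnd ℂ) (RingHom.id ℂ) B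
      (fun a b c => tendsto_nhds_unique (hB2 _ _) (by
        simpa [inner_add_left] using (hB2 a c).add (hB2 b c)))
      (fun r a c => tendsto_nhds_unique (hB2 _ _) (by
        simpa [inner_smul_left, mul_comm] using (hB2 a c).const_mul ((starRingEnd ℂ) r)))
      (fun a b c => tendsto_nhds_unique (hB2 _ _) (by
        simpa [inner_add_right] using (hB2 a b).add (hB2 a c)))
      (fun r a c => tendsto_nhds_unique (hB2 _ _) (by
        simpa [inner_smul_right] using (hB2 a c).const_mul r))) C
    (fun ξ η => hB1 ξ η)
  refine ⟨InnerProductSpace.continuousLinearMapOfBilin B', fun ξ η => ?_⟩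
  rw [InnerProductSpace.continuousLinearMapOfBilin_apply]
  exact hB2 ξ η

end Operators

section Algebras

variable {H : Type*} [NormedAddCommGroup H] [InnerProductSpace ℂ H] [CompleteSpace H]
variable {K : Type*} [NormedAddCommGroup K] [InnerProductSpace ℂ K] [CompleteSpace K]

/-- The von Neumann algebra tensor product `M ⊗̄ B(ℓ²)`, acting on `H ⊗ ℓ²`: the von Neumann algebra
generated by `M ⊗ 1` and `1 ⊗ B(ℓ²)`. -/
def ampAlg (M : VonNeumannAlgebra H) : VonNeumannAlgebra (Ell2 H) where
  toStarSubalgebra := StarSubalgebra.centralizer ℂ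
    (StarSubalgebra.centralizer ℂ (tensorOne '' (M : Set (H →L[ℂ] H)) ∪ scalarOps H) : Set _)
  centralizer_centralizer' := by simp

/-- `M ⊗̄ B(ℓ²)` consists of the operators all of whose matrix entries are in `M`. -/
theorem mem_ampAlg_iff {M : VonNeumannAlgebra H} {x : Ell2 H →L[ℂ] Ell2 H} :
    x ∈ ampAlg M ↔ ∀ i j, entry x i j ∈ M := by
  have hS : (ampAlg M : Set (Ell2 H →L[ℂ] Ell2 H)) = Set.centralizer (Set.centralizer
      (tensorOne '' (M : Set (H →L[ℂ] H)) ∪ scalarOps H)) := by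
    have h1 : star (tensorOne '' (M : Set (H →L[ℂ] H)) ∪ scalarOps H) ⊆
        tensorOne '' (M : Set (H →L[ℂ] H)) ∪ scalarOps H := by
      intro y hy
      rcases hy with ⟨a, ha, hy⟩ | hy
      · refine Or.inl ⟨star a, star_mem ha, ?_⟩
        rw [← star_star y, ← hy]
        refine entry_ext fun i j => ?_
        rw [entry_star, entry_tensorOne, entry_tensorOne]
        by_cases hij : i = j
        · simp [hij]
        · simp [hij, Ne.symm hij]
      · refine Or.inr fun i j => ?_
        obtain ⟨c, hc⟩ := hy j i
        refine ⟨star c, ?_⟩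
        rw [← star_star y, entry_star, hc]
        simp
    have h2 := StarSubalgebra.coe_centralizer_centralizer ℂ
      (tensorOne '' (M : Set (H →L[ℂ] H)) ∪ scalarOps H)
    rw [Set.union_eq_self_of_subset_right h1] at h2
    exact h2
  rw [← SetLike.mem_coe, hS]
  constructor
  · intro hx i j
    rw [← SetLike.mem_coe, ← M.centralizer_centralizer]
    intro T hT
    have hT' : tensorOne T ∈ Set.centralizer
        (tensorOne '' (M : Set (H →L[ℂ] H)) ∪ scalarOps H) := by
      rintro y (⟨a, ha, rfl⟩ | hy)
      · refine entry_ext fun k l => ?_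
        rw [entry_mul_tensorOne, entry_tensorOne_mul, entry_tensorOne]
        split_ifs
        · exact hT a ha
        · simp
      · refine entry_ext fun k l => ?_
        obtain ⟨c, hc⟩ := hy k l
        rw [entry_mul_tensorOne, entry_tensorOne_mul, hc]
        simp
    have := congrArg (fun z => entry z i j) (hx _ hT')
    simpa only [entry_mul_tensorOne, entry_tensorOne_mul] using this
  · intro hx y hy
    -- the matrix unit with entry `1` in position `(k, l)`
    let e : ℕ → ℕ → Ell2 H →L[ℂ] Ell2 H := fun k l => (inj H k).comp (coord H l)
    have he : ∀ k l, e k l ∈ scalarOps H := fun k l i j => by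
      refine ⟨if i = k ∧ l = j then 1 else 0, ?_⟩
      ext v
      by_cases hi : i = k <;> by_cases hj : l = j <;> simp [e, entry_apply, hi, hj]
    have hc : ∀ k l v, y (lp.single 2 k v) = lp.single 2 k (y (lp.single 2 l v) l) := by
      intro k l v
      have := congrArg (fun z : Ell2 H →L[ℂ] Ell2 H => z (lp.single 2 l v))
        (hy _ (Or.inr (he k l)))
      simpa [e] using this.symm
    have hyT : y = tensorOne (entry y 0 0) := by
      refine lp.ext_continuousLinearMap (by norm_num) fun k => ?_
      ext1 v
      change y (lp.single 2 k v) = tensorOne (entry y 0 0) (lp.single 2 k v)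
      rw [tensorOne_single, hc k 0 v, entry_apply]
    have hT : entry y 0 0 ∈ Set.centralizer (M : Set (H →L[ℂ] H)) := by
      intro a ha
      have := congrArg (fun z => entry z 0 0) (hy _ (Or.inl ⟨a, ha, rfl⟩))
      simpa only [entry_mul_tensorOne, entry_tensorOne_mul] using this
    rw [hyT]
    refine entry_ext fun i j => ?_
    rw [entry_mul_tensorOne, entry_tensorOne_mul]
    exact (hT _ (hx i j)).symm

theorem isClosed_vonNeumann (M : VonNeumannAlgebra H) :
    IsClosed (M.toStarSubalgebra : Set (H →L[ℂ] H)) := by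
  rw [VonNeumannAlgebra.coe_toStarSubalgebra, ← M.centralizer_centralizer]
  exact Set.isClosed_centralizer _

/-- The operators in the upper left `n × n` block of `M ⊗̄ B(ℓ²)`. -/
def blockAlg (M : VonNeumannAlgebra H) (n : ℕ) :
    NonUnitalStarSubalgebra ℂ (Ell2 H →L[ℂ] Ell2 H) where
  carrier := {y | (∀ i j, entry y i j ∈ M.toStarSubalgebra) ∧
    ∀ i j, n ≤ i ∨ n ≤ j → entry y i j = 0}
  add_mem' := fun hx hy => ⟨fun i j => by rw [entry_add]; exact add_mem (hx.1 i j) (hy.1 i j),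
    fun i j h => by rw [entry_add, hx.2 i j h, hy.2 i j h, add_zero]⟩
  zero_mem' := ⟨fun i j => by rw [entry_zero]; exact zero_mem _, fun i j _ => entry_zero i j⟩
  mul_mem' := by
    intro x y hx hy
    have h : ∀ i j, entry (x * y) i j = ∑ k ∈ Finset.range n, entry x i k * entry y k j :=
      fun i j => entry_mul_of_column x y n i j fun k hk => hy.2 k j (Or.inl hk)
    refine ⟨fun i j => ?_, fun i j hij => ?_⟩
    · rw [h]
      exact sum_mem fun k _ => mul_mem (hx.1 i k) (hy.1 k j)
    · rw [h]
      refine Finset.sum_eq_zero fun k _ => ?_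
      rcases hij with hi | hj
      · rw [hx.2 i k (Or.inl hi), zero_mul]
      · rw [hy.2 k j (Or.inr hj), mul_zero]
  smul_mem' := fun c x hx => ⟨fun i j => by
      rw [entry_smul]; exact SMulMemClass.smul_mem c (hx.1 i j),
    fun i j h => by rw [entry_smul, hx.2 i j h, smul_zero]⟩
  star_mem' := fun hx => ⟨fun i j => by rw [entry_star]; exact star_mem (hx.1 j i),
    fun i j h => by rw [entry_star, hx.2 j i h.symm, star_zero]⟩

theorem isClosed_blockAlg (M : VonNeumannAlgebra H) (n : ℕ) :
    IsClosed (blockAlg M n : Set (Ell2 H →L[ℂ] Ell2 H)) := by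
  have : (blockAlg M n : Set (Ell2 H →L[ℂ] Ell2 H)) =
      (⋂ i, ⋂ j, (fun x => entry x i j) ⁻¹' (M.toStarSubalgebra : Set (H →L[ℂ] H))) ∩
      ⋂ i, ⋂ j, ⋂ _ : n ≤ i ∨ n ≤ j, (fun x => entry x i j) ⁻¹' {0} := by
    ext y
    simp only [Set.mem_inter_iff, Set.mem_iInter, Set.mem_preimage, Set.mem_singleton_iff]
    rfl
  rw [this]
  refine IsClosed.inter ?_ ?_
  · exact isClosed_iInter fun i => isClosed_iInter fun j =>
      (isClosed_vonNeumann M).preimage (continuous_entry i j)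
  · exact isClosed_iInter fun i => isClosed_iInter fun j => isClosed_iInter fun _ =>
      isClosed_singleton.preimage (continuous_entry i j)

variable {M : VonNeumannAlgebra H} {N : VonNeumannAlgebra K}

/-- Entrywise application of a `*`-homomorphism to `n × n` blocks. -/
def blockHom (φ : M.toStarSubalgebra →⋆ₐ[ℂ] N.toStarSubalgebra) (n : ℕ) :
    blockAlg M n →⋆ₙₐ[ℂ] (Ell2 K →L[ℂ] Ell2 K) where
  toFun := fun y => ofBlock n fun i j => (φ ⟨entry y.1 i j, y.2.1 i j⟩ : K →L[ℂ] K)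
  map_smul' := fun c x => by
    refine entry_ext fun i j => ?_
    simp only [entry_ofBlock, entry_smul, MonoidHom.id_apply]
    split_ifs with h
    · have : (⟨entry (c • x : blockAlg M n).1 i j, (c • x).2.1 i j⟩ : M.toStarSubalgebra) =
        c • ⟨entry x.1 i j, x.2.1 i j⟩ := Subtype.ext (entry_smul c x.1 i j)
      rw [this, map_smul]; rfl
    · simp
  map_zero' := by
    refine entry_ext fun i j => ?_
    simp only [entry_ofBlock, entry_zero]
    split_ifs with h
    · have : (⟨entry (0 : blockAlg M n).1 i j, (0 : blockAlg M n).2.1 i j⟩ :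
        M.toStarSubalgebra) = 0 := Subtype.ext (entry_zero i j)
      rw [this, map_zero]; rfl
    · rfl
  map_add' := fun x y => by
    refine entry_ext fun i j => ?_
    simp only [entry_ofBlock, entry_add]
    split_ifs with h
    · have : (⟨entry (x + y : blockAlg M n).1 i j, (x + y).2.1 i j⟩ : M.toStarSubalgebra) =
        ⟨entry x.1 i j, x.2.1 i j⟩ + ⟨entry y.1 i j, y.2.1 i j⟩ :=
          Subtype.ext (entry_add x.1 y.1 i j)
      rw [this, map_add]; rfl
    · simp
  map_mul' := fun x y => by
    refine entry_ext fun i j => ?_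
    rw [entry_mul_of_column _ _ n i j fun k hk => by rw [entry_ofBlock, if_neg (by omega)]]
    simp only [entry_ofBlock]
    split_ifs with h
    · have : (⟨entry (x * y : blockAlg M n).1 i j, (x * y).2.1 i j⟩ : M.toStarSubalgebra) =
        ∑ k ∈ Finset.range n, ⟨entry x.1 i k, x.2.1 i k⟩ * ⟨entry y.1 k j, y.2.1 k j⟩ := by
          refine Subtype.ext ?_
          rw [AddSubmonoidClass.coe_finsetSum]
          exact entry_mul_of_column x.1 y.1 n i j fun k hk => y.2.2 k j (Or.inl hk)
      rw [this, map_sum, AddSubmonoidClass.coe_finsetSum]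
      refine Finset.sum_congr rfl fun k hk => ?_
      rw [if_pos ⟨h.1, Finset.mem_range.1 hk⟩, if_pos ⟨Finset.mem_range.1 hk, h.2⟩, map_mul]
      rfl
    · refine (Finset.sum_eq_zero fun k hk => ?_).symm
      by_cases hi : i < n
      · rw [if_neg (fun h' : k < n ∧ j < n => h ⟨hi, h'.2⟩), mul_zero]
      · rw [if_neg (fun h' : i < n ∧ k < n => hi h'.1), zero_mul]
  map_star' := fun x => by
    refine entry_ext fun i j => ?_
    simp only [entry_ofBlock, entry_star]
    by_cases h : i < n ∧ j < n
    · have : (⟨entry (star x : blockAlg M n).1 i j, (star x).2.1 i j⟩ : M.toStarSubalgebra) =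
        star ⟨entry x.1 j i, x.2.1 j i⟩ := Subtype.ext (entry_star x.1 i j)
      rw [if_pos h, if_pos h.symm, this, map_star]; rfl
    · rw [if_neg h, if_neg (fun h' => h h'.symm), star_zero]

theorem norm_blockHom_le (φ : M.toStarSubalgebra →⋆ₐ[ℂ] N.toStarSubalgebra) (n : ℕ)
    (y : blockAlg M n) : ‖blockHom φ n y‖ ≤ ‖(y : Ell2 H →L[ℂ] Ell2 H)‖ := by
  let _ : NonUnitalCStarAlgebra (blockAlg M n) :=
    NonUnitalStarSubalgebra.nonUnitalCStarAlgebra (blockAlg M n)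
      (h_closed := isClosed_blockAlg M n)
  exact NonUnitalStarAlgHom.norm_apply_le (F := blockAlg M n →⋆ₙₐ[ℂ] (Ell2 K →L[ℂ] Ell2 K))
    (blockHom φ n) y

theorem norm_truncate_le (x : Ell2 H →L[ℂ] Ell2 H) (n : ℕ) :
    ‖ofBlock n fun i j => entry x i j‖ ≤ ‖x‖ := by
  let P : Ell2 H →L[ℂ] Ell2 H := ∑ i ∈ Finset.range n, (inj H i).comp (coord H i)
  have hP : ∀ ξ m, P ξ m = if m ∈ Finset.range n then ξ m else 0 := by
    intro ξ m
    simp only [P, sum_apply, lp.coeFn_sum, Finset.sum_apply, ContinuousLinearMap.comp_apply,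
      inj_apply, coord_apply, lp.single_apply]
    rw [Finset.sum_pi_single]
  have hP1 : ‖P‖ ≤ 1 := P.opNorm_le_bound zero_le_one fun ξ => by
    rw [one_mul]
    refine lp.norm_mono (by norm_num) fun m => ?_
    rw [hP]
    split_ifs <;> simp
  have hPs : ∀ j v, P (lp.single 2 j v) = if j < n then lp.single 2 j v else 0 := by
    intro j v
    ext m
    rw [hP]
    by_cases hm : m = j
    · subst hm
      by_cases hmn : m < n <;> simp [hmn]
    · by_cases hj : j < n <;> simp [hj, hm]
  have h : (ofBlock n fun i j => entry x i j) = P * (x * P) := by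
    refine entry_ext fun i j => ?_
    ext v
    rw [entry_ofBlock, entry_apply, mul_apply_eq_comp, hP, mul_apply_eq_comp, hPs]
    by_cases hi : i < n <;> by_cases hj : j < n <;> simp [hi, hj, entry_apply]
  rw [h]
  calc ‖P * (x * P)‖ ≤ ‖P‖ * (‖x‖ * ‖P‖) :=
        (norm_mul_le _ _).trans (by gcongr; exact norm_mul_le _ _)
    _ ≤ 1 * (‖x‖ * 1) := by gcongr
    _ = ‖x‖ := by ring

/-- For `x ∈ M ⊗̄ B(ℓ²)`, the matrix obtained by applying `φ` to all entries of `x` is the matrix of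
a unique bounded operator. -/
theorem existsUnique_amplify (φ : M.toStarSubalgebra →⋆ₐ[ℂ] N.toStarSubalgebra) (x : ampAlg M) :
    ∃! y : Ell2 K →L[ℂ] Ell2 K, ∀ i j,
      entry y i j = φ ⟨entry x.1 i j, mem_ampAlg_iff.1 x.2 i j⟩ := by
  have hmem : ∀ n, (ofBlock n fun i j => entry x.1 i j) ∈ blockAlg M n := fun n =>
    ⟨fun i j => by
      rw [entry_ofBlock]
      split_ifs
      · exact mem_ampAlg_iff.1 x.2 i j
      · exact zero_mem _,
    fun i j h => by rw [entry_ofBlock, if_neg (by omega)]⟩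
  let Y : ℕ → Ell2 K →L[ℂ] Ell2 K := fun n => blockHom φ n ⟨_, hmem n⟩
  have hY : ∀ n, ‖Y n‖ ≤ ‖x.1‖ := fun n =>
    (norm_blockHom_le φ n ⟨_, hmem n⟩).trans (norm_truncate_le x.1 n)
  have hYe : ∀ n i j, i < n → j < n →
      entry (Y n) i j = φ ⟨entry x.1 i j, mem_ampAlg_iff.1 x.2 i j⟩ := by
    intro n i j hi hj
    have h : entry (ofBlock n fun i j => entry x.1 i j) i j = entry x.1 i j := by
      rw [entry_ofBlock, if_pos ⟨hi, hj⟩]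
    change entry (ofBlock n _) i j = _
    rw [entry_ofBlock, if_pos ⟨hi, hj⟩]
    simp only [h]
  obtain ⟨T, hT⟩ := exists_weak_limit Y _ hY
  have hTe : ∀ i j, entry T i j = φ ⟨entry x.1 i j, mem_ampAlg_iff.1 x.2 i j⟩ := by
    intro i j
    refine ContinuousLinearMap.ext fun v => ext_inner_right ℂ fun w => ?_
    have h1 := hT (lp.single 2 j v) (lp.single 2 i w)
    rw [lp.inner_single_right] at h1
    refine tendsto_nhds_unique h1 (tendsto_const_nhds.congr' ?_)
    have h2 : ∀ᶠ n in (Filter.hyperfilter ℕ : Filter ℕ), max i j < n :=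
      Nat.hyperfilter_le_atTop (Filter.eventually_gt_atTop _)
    filter_upwards [h2] with n hn
    rw [lp.inner_single_right, ← hYe n i j (by omega) (by omega)]
    rfl
  exact ⟨T, hTe, fun y hy => entry_ext fun i j => (hy i j).trans (hTe i j).symm⟩

/-- The map `φ ⊗ 1` on `M ⊗̄ B(ℓ²)`, for a `*`-homomorphism `φ`: it applies `φ` to all matrix
entries. -/
def amplify (φ : M.toStarSubalgebra →⋆ₐ[ℂ] N.toStarSubalgebra) (x : ampAlg M) :
    Ell2 K →L[ℂ] Ell2 K :=
  (existsUnique_amplify φ x).choose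

theorem entry_amplify (φ : M.toStarSubalgebra →⋆ₐ[ℂ] N.toStarSubalgebra) (x : ampAlg M)
    (i j : ℕ) :
    entry (amplify φ x) i j = φ ⟨entry x.1 i j, mem_ampAlg_iff.1 x.2 i j⟩ :=
  (existsUnique_amplify φ x).choose_spec.1 i j

/-! ### Projections -/

/-- `Pr(A)`, the projections of a von Neumann algebra `A`. -/
def projections (A : VonNeumannAlgebra H) : Set (H →L[ℂ] H) :=
  {p | p ∈ A ∧ IsStarProjection p}

/-- The join `⋁ S` of a set of projections: the projection onto the closed linear span of their
ranges. -/
def projSup (S : Set (H →L[ℂ] H)) : H →L[ℂ] H :=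
  (⨆ p ∈ S, p.range).topologicalClosure.starProjection

/-- The range projection `[x]`. -/
def rangeProj (x : H →L[ℂ] H) : H →L[ℂ] H :=
  x.range.topologicalClosure.starProjection

/-! ### The weak* topology -/

/-- The weak* (ultraweak) topology of `B(H)`: the coarsest topology for which all functionals
`a ↦ ∑ₙ ⟪ξₙ, a ηₙ⟫`, with `(ξₙ)` and `(ηₙ)` square-summable, are continuous. -/
abbrev weakStar (H : Type*) [NormedAddCommGroup H] [InnerProductSpace ℂ H] :
    TopologicalSpace (H →L[ℂ] H) :=
  ⨅ (ξ : Ell2 H) (η : Ell2 H),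
    TopologicalSpace.induced (fun a => ∑' n, ⟪ξ n, a (η n)⟫_ℂ) inferInstance

/-- The weak*-closed linear span of a set of operators. -/
def weakStarSpan (S : Set (H →L[ℂ] H)) : Submodule ℂ (H →L[ℂ] H) :=
  sInf {W | IsClosed[weakStar H] (W : Set (H →L[ℂ] H)) ∧ S ⊆ W}

/-! ### Quantum relations and quantum coarse structures -/

/-- A quantum relation on `M ⊆ B(H)`: a weak*-closed `M'`-`M'`-bimodule in `B(H)`. -/
structure IsQuantumRelation (M : VonNeumannAlgebra H) (V : Submodule ℂ (H →L[ℂ] H)) : Prop where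
  isClosed : IsClosed[weakStar H] (V : Set (H →L[ℂ] H))
  left_mem : ∀ s ∈ M.commutant, ∀ a ∈ V, s * a ∈ V
  right_mem : ∀ s ∈ M.commutant, ∀ a ∈ V, a * s ∈ V

/-- The space `V*` of adjoints of the elements of `V`. -/
def adjointSpace (V : Submodule ℂ (H →L[ℂ] H)) : Submodule ℂ (H →L[ℂ] H) where
  carrier := {a | star a ∈ V}
  add_mem' := fun ha hb => by
    rw [Set.mem_ofPred_eq, star_add]; exact V.add_mem ha hb
  zero_mem' := by rw [Set.mem_ofPred_eq, star_zero]; exact V.zero_mem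
  smul_mem' := fun c a ha => by
    rw [Set.mem_ofPred_eq, star_smul]; exact V.smul_mem _ ha

/-- The commutant `M'` as a linear space of operators. -/
def commutantSpace (M : VonNeumannAlgebra H) : Submodule ℂ (H →L[ℂ] H) :=
  Subalgebra.toSubmodule M.commutant.toStarSubalgebra.toSubalgebra

/-- A quantum coarse structure on `M ⊆ B(H)`. -/
structure IsQuantumCoarseStructure (M : VonNeumannAlgebra H)
    (𝒱 : Set (Submodule ℂ (H →L[ℂ] H))) : Prop where
  isQuantumRelation : ∀ V ∈ 𝒱, IsQuantumRelation M V
  diagonal_mem : commutantSpace M ∈ 𝒱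
  mem_of_le : ∀ V₁ ∈ 𝒱, ∀ V₂, IsQuantumRelation M V₂ → V₂ ≤ V₁ → V₂ ∈ 𝒱
  adjoint_mem : ∀ V ∈ 𝒱, adjointSpace V ∈ 𝒱
  sum_mem : ∀ V₁ ∈ 𝒱, ∀ V₂ ∈ 𝒱, weakStarSpan ((V₁ : Set (H →L[ℂ] H)) ∪ V₂) ∈ 𝒱
  mul_mem : ∀ V₁ ∈ 𝒱, ∀ V₂ ∈ 𝒱,
    weakStarSpan {x : H →L[ℂ] H | ∃ a ∈ V₁, ∃ b ∈ V₂, x = a * b} ∈ 𝒱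

/-! ### Intrinsic quantum relations -/

/-- Sets of pairs of operators on `H ⊗ ℓ²`; intrinsic quantum relations are such sets. -/
abbrev PairSet (H : Type*) [NormedAddCommGroup H] [InnerProductSpace ℂ H] : Type _ :=
  Set ((Ell2 H →L[ℂ] Ell2 H) × (Ell2 H →L[ℂ] Ell2 H))

/-- An intrinsic quantum relation on `M`: a relatively open set of pairs of projections of
`P = Pr(M ⊗̄ B(ℓ²))`, where `P` carries the weak operator topology, with the properties
* `(0, 0) ∉ R`,
* `(⋁ pᵢ, ⋁ qⱼ) ∈ R` if and only if `(pᵢ, qⱼ) ∈ R` for some `i`, `j`, for nonzero `pᵢ, qⱼ ∈ P`,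
* `(p, [b q]) ∈ R` if and only if `([b* p], q) ∈ R`, for `p, q ∈ P` and `b ∈ 1 ⊗ B(ℓ²)`. -/
structure IsIntrinsicQuantumRelation (M : VonNeumannAlgebra H) (R : PairSet H) : Prop where
  subset : R ⊆ projections (ampAlg M) ×ˢ projections (ampAlg M)
  isOpen : ∃ U : Set ((Ell2 H →WOT[ℂ] Ell2 H) × (Ell2 H →WOT[ℂ] Ell2 H)), IsOpen U ∧
    ∀ p ∈ projections (ampAlg M), ∀ q ∈ projections (ampAlg M),
      (p, q) ∈ R ↔ (ContinuousLinearMapWOT.ofCLM p, ContinuousLinearMapWOT.ofCLM q) ∈ U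
  zero_notMem : (0, 0) ∉ R
  sup_mem_iff : ∀ S ⊆ projections (ampAlg M), ∀ T ⊆ projections (ampAlg M), 0 ∉ S → 0 ∉ T →
    ((projSup S, projSup T) ∈ R ↔ ∃ p ∈ S, ∃ q ∈ T, (p, q) ∈ R)
  range_mem_iff : ∀ p ∈ projections (ampAlg M), ∀ q ∈ projections (ampAlg M),
    ∀ b ∈ scalarOps H, ((p, rangeProj (b * q)) ∈ R ↔ (rangeProj (star b * p), q) ∈ R)

/-- The intrinsic quantum relation `R_V` of a quantum relation `V` on `M`. -/
def intrinsic (M : VonNeumannAlgebra H) (V : Submodule ℂ (H →L[ℂ] H)) : PairSet H :=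
  {pq | pq.1 ∈ projections (ampAlg M) ∧ pq.2 ∈ projections (ampAlg M) ∧
    ∃ a ∈ V, pq.1 * tensorOne a * pq.2 ≠ 0}

/-- The intrinsic quantum coarse structure `{R_V : V ∈ 𝒱}` of a quantum coarse structure `𝒱`. -/
def intrinsicStructure (M : VonNeumannAlgebra H) (𝒱 : Set (Submodule ℂ (H →L[ℂ] H))) :
    Set (PairSet H) :=
  intrinsic M '' 𝒱

/-! ### Quantum functions -/

/-- A quantum function `M → N`: a unital weak*-continuous `*`-homomorphism. -/
structure QuantumFunction (M : VonNeumannAlgebra H) (N : VonNeumannAlgebra K) where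
  /-- The underlying unital `*`-homomorphism. -/
  toHom : M.toStarSubalgebra →⋆ₐ[ℂ] N.toStarSubalgebra
  continuous_weakStar :
    @Continuous _ _ (TopologicalSpace.induced Subtype.val (weakStar H))
      (TopologicalSpace.induced Subtype.val (weakStar K)) toHom

namespace QuantumFunction

/-- The identity of `M`. -/
def id (M : VonNeumannAlgebra H) : QuantumFunction M M where
  toHom := StarAlgHom.id ℂ M.toStarSubalgebra
  continuous_weakStar :=
    @continuous_id _ (TopologicalSpace.induced Subtype.val (weakStar H))

/-- The composition `ψ ∘ φ`. -/
def comp {L : Type*} [NormedAddCommGroup L] [InnerProductSpace ℂ L] [CompleteSpace L]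
    {O : VonNeumannAlgebra L} (ψ : QuantumFunction N O) (φ : QuantumFunction M N) :
    QuantumFunction M O where
  toHom := ψ.toHom.comp φ.toHom
  continuous_weakStar :=
    @Continuous.comp _ _ _ (TopologicalSpace.induced Subtype.val (weakStar H))
      (TopologicalSpace.induced Subtype.val (weakStar K))
      (TopologicalSpace.induced Subtype.val (weakStar L)) _ _
      ψ.continuous_weakStar φ.continuous_weakStar

/-- The pullback `φ*(Q)`: the pairs `(p, q)` of projections of `M ⊗̄ B(ℓ²)` with
`((φ ⊗ 1)(p), (φ ⊗ 1)(q)) ∈ Q`. -/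
def pullback (φ : QuantumFunction M N) (Q : PairSet K) : PairSet H :=
  {pq | ∃ (hp : pq.1 ∈ projections (ampAlg M)) (hq : pq.2 ∈ projections (ampAlg M)),
    (amplify φ.toHom ⟨pq.1, hp.1⟩, amplify φ.toHom ⟨pq.2, hq.1⟩) ∈ Q}

/-- `φ` is quantum coarse: `φ*` maps the intrinsic quantum coarse structure of `N` into that
of `M`. -/
def IsCoarse (φ : QuantumFunction M N) (𝒱 : Set (Submodule ℂ (H →L[ℂ] H)))
    (𝒰 : Set (Submodule ℂ (K →L[ℂ] K))) : Prop :=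
  ∀ Q ∈ intrinsicStructure N 𝒰, φ.pullback Q ∈ intrinsicStructure M 𝒱

/-- `φ` is quantum expanding: an intrinsic quantum relation on `N` belongs to the intrinsic quantum
coarse structure of `N` as soon as its pullback belongs to that of `M`. -/
def IsExpanding (φ : QuantumFunction M N) (𝒱 : Set (Submodule ℂ (H →L[ℂ] H)))
    (𝒰 : Set (Submodule ℂ (K →L[ℂ] K))) : Prop :=
  ∀ Q : PairSet K, IsIntrinsicQuantumRelation N Q →
    φ.pullback Q ∈ intrinsicStructure M 𝒱 → Q ∈ intrinsicStructure N 𝒰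

/-- Quantum functions `φ, ψ : M → N` are quantum close with respect to a quantum coarse structure
on `M`. -/
def IsClose (𝒱 : Set (Submodule ℂ (H →L[ℂ] H))) (φ ψ : QuantumFunction M N) : Prop :=
  ∃ R ∈ intrinsicStructure M 𝒱,
    ∀ (p q : Ell2 H →L[ℂ] Ell2 H) (hp : p ∈ projections (ampAlg M))
      (hq : q ∈ projections (ampAlg M)),
      amplify φ.toHom ⟨p, hp.1⟩ * amplify ψ.toHom ⟨q, hq.1⟩ ≠ 0 → (p, q) ∈ R

/-- `φ` is a quantum coarse equivalence: it is quantum coarse and has a quantum coarse inverse. -/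
def IsCoarseEquivalence (φ : QuantumFunction M N) (𝒱 : Set (Submodule ℂ (H →L[ℂ] H)))
    (𝒰 : Set (Submodule ℂ (K →L[ℂ] K))) : Prop :=
  φ.IsCoarse 𝒱 𝒰 ∧ ∃ ψ : QuantumFunction N M, ψ.IsCoarse 𝒰 𝒱 ∧
    IsClose 𝒱 (ψ.comp φ) (id M) ∧ IsClose 𝒰 (φ.comp ψ) (id N)

end QuantumFunction

/-- `(M, 𝒱)` and `(N, 𝒰)` are quantum coarsely equivalent. -/
def CoarselyEquivalent (M : VonNeumannAlgebra H) (𝒱 : Set (Submodule ℂ (H →L[ℂ] H)))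
    (N : VonNeumannAlgebra K) (𝒰 : Set (Submodule ℂ (K →L[ℂ] K))) : Prop :=
  ∃ φ : QuantumFunction M N, φ.IsCoarseEquivalence 𝒱 𝒰

/-! ### Quantum asymptotic dimension -/

/-- A set `P` of projections is `R`-disjoint: `(p ⊗ 1, q ⊗ 1) ∉ R` for distinct `p, q ∈ P`. -/
def IsDisjointFamily (R : PairSet H) (P : Set (H →L[ℂ] H)) : Prop :=
  ∀ p ∈ P, ∀ q ∈ P, p ≠ q → (tensorOne p, tensorOne q) ∉ R

/-- The diameter of `p ∈ Pr(M)` is at most `R`: all pairs `(r, s)` of projections of `M ⊗̄ B(ℓ²)`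
such that `r (p a p ⊗ 1) s ≠ 0` for some `a ∈ B(H)` belong to `R`. -/
def DiamLE (M : VonNeumannAlgebra H) (p : H →L[ℂ] H) (R : PairSet H) : Prop :=
  ∀ r ∈ projections (ampAlg M), ∀ s ∈ projections (ampAlg M),
    (∃ a : H →L[ℂ] H, r * tensorOne (p * a * p) * s ≠ 0) → (r, s) ∈ R

/-- A set of projections of `M` is uniformly bounded. -/
def IsUniformlyBounded (M : VonNeumannAlgebra H) (𝒱 : Set (Submodule ℂ (H →L[ℂ] H)))
    (P : Set (H →L[ℂ] H)) : Prop :=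
  ∃ R ∈ intrinsicStructure M 𝒱, ∀ p ∈ P, DiamLE M p R

/-- `(M, 𝒱)` has asymptotic dimension at most `n`. -/
def AsydimLE (M : VonNeumannAlgebra H) (𝒱 : Set (Submodule ℂ (H →L[ℂ] H))) (n : ℕ) : Prop :=
  ∀ R ∈ intrinsicStructure M 𝒱, ∃ P : Fin (n + 1) → Set (H →L[ℂ] H),
    (∀ i, P i ⊆ projections M) ∧
    projSup (⋃ i, P i) = 1 ∧
    (∀ i, IsDisjointFamily R (P i)) ∧
    ∀ i, IsUniformlyBounded M 𝒱 (P i)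

/-- The quantum asymptotic dimension: the least `n` such that `(M, 𝒱)` has asymptotic dimension at
most `n`, and `⊤` if there is no such `n`. -/
def asydim (M : VonNeumannAlgebra H) (𝒱 : Set (Submodule ℂ (H →L[ℂ] H))) : ℕ∞ :=
  sInf {d : ℕ∞ | ∃ n : ℕ, d = n ∧ AsydimLE M 𝒱 n}

end Algebras

end

end QuantumCoarse

set_option linter.unusedSectionVars false

namespace QuantumCoarse

/-! ### Amplifications and the commutant of `B(H) ⊗ 1` -/

section Amplification

variable {H : Type*} [NormedAddCommGroup H] [InnerProductSpace ℂ H]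

/-! Let `φ` be quantum coarse and expanding, and let `R` be a relation to be tested on `N`. A cover
of `M` adapted to `φ*(R)` is pushed forward by `φ`. Disjointness transfers because `(φ ⊗ 1)(p ⊗ 1) =
φ(p) ⊗ 1`. The join stays `1` by normality: for a vector `v` orthogonal to the ranges of all `φ(p)`,
the set of `x` with `φ(x) v = 0` is a weak*-closed left ideal, hence `M(1 - z)` for a projection
`z`; then `p z = 0` for every `p`, so `z = 0` and `v = 0` (`projSup_imageSet`).

The substance is uniform boundedness. For a family `P` put `W = span{φ(r) B(K) φ(r)}` and let `z` be
the support projection of `φ`. The pullback of `R_W` is the relation of `span{r z B(H) z r}`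
(`pullback_intrinsic_sandwich`). That span lies in the quantum relation bounding the diameters of
`P`, since a quantum relation can be recovered from its intrinsic relation (`mem_of_intrinsic`).
Expansion then puts `R_W` into the structure of `N`, and `R_W` bounds every `φ(r)`.

The pullback formula has to compare conditions involving `B(H)` with conditions involving `B(K)`,
although `φ` is defined on `M` only. The bridge is that `x (B(H) ⊗ 1) y = 0` holds exactly when some
`b` in `1 ⊗ B(ℓ²)` satisfies `x b = 0` and `b y = y` (the nontrivial direction is
`exists_scalarOps_separating`). Scalar matrices do not see the Hilbert space, and `φ ⊗ 1` preserves
them; it is multiplicative because `φ` is normal. The projection `z` accounts for the kernel of `φ`.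

For a coarse equivalence only the expansion of relations of the form `R_W` is needed
(`ExpandsQuantumRelations`). If `φ ∘ ψ` is close to the identity along `U₀` and `ψ*φ*(R_W) =
R_{U₁}`, then `W` is contained in the weak*-closed product `U₀* U₁ U₀`, the analogue of the
classical estimate by the triangle inequality. -/

theorem tensorOne_mul (a b : H →L[ℂ] H) : tensorOne (a * b) = tensorOne a * tensorOne b := rfl

theorem tensorOne_one : tensorOne (1 : H →L[ℂ] H) = 1 := rfl

theorem tensorOne_zero : tensorOne (0 : H →L[ℂ] H) = 0 := rfl

theorem tensorOne_add (a b : H →L[ℂ] H) : tensorOne (a + b) = tensorOne a + tensorOne b := rfl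

theorem tensorOne_smul (c : ℂ) (a : H →L[ℂ] H) : tensorOne (c • a) = c • tensorOne a := rfl

/-- Identifies the functionals defining the weak* topology with matrix coefficients of `a ⊗ 1`, so
that weak* questions become Hilbert space geometry in `H ⊗ ℓ²`. -/
theorem inner_tensorOne (ξ η : Ell2 H) (a : H →L[ℂ] H) :
    ⟪ξ, tensorOne a η⟫_ℂ = ∑' n, ⟪ξ n, a (η n)⟫_ℂ :=
  lp.inner_eq_tsum ξ (tensorOne a η)

theorem scalarOps_commute {b : Ell2 H →L[ℂ] Ell2 H} (hb : b ∈ scalarOps H) (a : H →L[ℂ] H) :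
    tensorOne a * b = b * tensorOne a := by
  refine entry_ext fun i j => ?_
  obtain ⟨c, hc⟩ := hb i j
  rw [entry_mul_tensorOne, entry_tensorOne_mul, hc]
  simp

/-- The operators on `H ⊗ ℓ²` commuting with `B(H) ⊗ 1` are those of `1 ⊗ B(ℓ²)`. -/
theorem mem_scalarOps_of_commute {b : Ell2 H →L[ℂ] Ell2 H}
    (hb : ∀ a : H →L[ℂ] H, tensorOne a * b = b * tensorOne a) : b ∈ scalarOps H := by
  intro i j
  have h : entry b i j ∈ Subalgebra.center ℂ (H →L[ℂ] H) := by
    rw [Subalgebra.mem_center_iff]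
    intro a
    rw [← entry_mul_tensorOne, ← entry_tensorOne_mul, hb]
  rw [Algebra.IsCentral.center_eq_bot] at h
  obtain ⟨c, hc⟩ := Algebra.mem_bot.1 h
  exact ⟨c, by rw [← hc, Algebra.algebraMap_eq_smul_one]⟩

theorem mem_topologicalClosure_of_forall {U : Submodule ℂ H} {T : H →L[ℂ] H}
    {W : Submodule ℂ H} (hW : IsClosed (W : Set H)) (h : ∀ ξ ∈ U, T ξ ∈ W) :
    ∀ ξ ∈ U.topologicalClosure, T ξ ∈ W := by
  have : U.topologicalClosure ≤ W.comap (T : H →ₗ[ℂ] H) :=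
    U.topologicalClosure_minimal h (hW.preimage T.continuous)
  exact fun ξ hξ => this hξ

variable [CompleteSpace H]

theorem star_tensorOne (a : H →L[ℂ] H) : star (tensorOne a) = tensorOne (star a) := by
  refine entry_ext fun i j => ?_
  rw [entry_star, entry_tensorOne, entry_tensorOne]
  by_cases hij : i = j
  · simp [hij]
  · simp [hij, Ne.symm hij]

theorem inner_star_left (x : H →L[ℂ] H) (ξ η : H) : ⟪star x ξ, η⟫_ℂ = ⟪ξ, x η⟫_ℂ := by
  rw [ContinuousLinearMap.star_eq_adjoint, ContinuousLinearMap.adjoint_inner_left]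

theorem inner_star_right (x : H →L[ℂ] H) (ξ η : H) : ⟪ξ, star x η⟫_ℂ = ⟪x ξ, η⟫_ℂ := by
  rw [ContinuousLinearMap.star_eq_adjoint, ContinuousLinearMap.adjoint_inner_right]

end Amplification

/-! ### Projections, joins and range projections in von Neumann algebras -/

section Projections

variable {H : Type*} [NormedAddCommGroup H] [InnerProductSpace ℂ H] [CompleteSpace H]

/-- A subspace invariant under both `T` and `T*` is reducing. This is how all projections below are
shown to lie in a prescribed commutant. -/
theorem commute_starProjection {U : Submodule ℂ H} [U.HasOrthogonalProjection] {T : H →L[ℂ] H}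
    (h : ∀ ξ ∈ U, T ξ ∈ U) (h' : ∀ ξ ∈ U, star T ξ ∈ U) :
    T * U.starProjection = U.starProjection * T := by
  ext ξ
  change T (U.starProjection ξ) = U.starProjection (T ξ)
  refine (Submodule.eq_starProjection_of_mem_of_inner_eq_zero
    (h _ (U.starProjection_apply_mem ξ)) fun w hw => ?_).symm
  rw [← map_sub, ← inner_star_right]
  exact U.starProjection_inner_eq_zero ξ _ (h' w hw)

/-- A closed subspace invariant under the commutant of `M` has its projection in `M`. -/
theorem starProjection_mem {M : VonNeumannAlgebra H} {U : Submodule ℂ H}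
    [U.HasOrthogonalProjection] (h : ∀ s ∈ M.commutant, ∀ ξ ∈ U, s ξ ∈ U) :
    U.starProjection ∈ projections M := by
  refine ⟨?_, isStarProjection_starProjection⟩
  rw [← M.commutant_commutant, VonNeumannAlgebra.mem_commutant_iff]
  intro s hs
  exact commute_starProjection (h s hs) (h _ (star_mem hs))

theorem mem_ampAlg_of_commute {M : VonNeumannAlgebra H} {x : Ell2 H →L[ℂ] Ell2 H}
    (hx : ∀ s ∈ M.commutant, tensorOne s * x = x * tensorOne s) : x ∈ ampAlg M := by
  rw [mem_ampAlg_iff]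
  intro i j
  rw [← M.commutant_commutant, VonNeumannAlgebra.mem_commutant_iff]
  intro s hs
  rw [← entry_mul_tensorOne, ← entry_tensorOne_mul, hx s hs]

/-- A closed subspace invariant under `M' ⊗ 1` has its projection in `M ⊗̄ B(ℓ²)`. -/
theorem starProjection_mem_ampAlg {M : VonNeumannAlgebra H} {U : Submodule ℂ (Ell2 H)}
    [U.HasOrthogonalProjection] (h : ∀ s ∈ M.commutant, ∀ ξ ∈ U, tensorOne s ξ ∈ U) :
    U.starProjection ∈ projections (ampAlg M) := by
  refine ⟨mem_ampAlg_of_commute fun s hs => ?_, isStarProjection_starProjection⟩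
  exact commute_starProjection (h s hs) (by rw [star_tensorOne]; exact h _ (star_mem hs))

theorem tensorOne_mem_ampAlg {M : VonNeumannAlgebra H} {a : H →L[ℂ] H} (ha : a ∈ M) :
    tensorOne a ∈ ampAlg M := by
  rw [mem_ampAlg_iff]
  intro i j
  rw [entry_tensorOne]
  split_ifs
  · exact ha
  · exact zero_mem _

theorem tensorOne_mem_projections {M : VonNeumannAlgebra H} {p : H →L[ℂ] H}
    (hp : p ∈ projections M) : tensorOne p ∈ projections (ampAlg M) := by
  refine ⟨tensorOne_mem_ampAlg hp.1, ?_, ?_⟩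
  · change _ * _ = _
    rw [← tensorOne_mul, hp.2.1.eq]
  · rw [isSelfAdjoint_iff, star_tensorOne, hp.2.2.star_eq]

theorem scalarOps_subset_ampAlg (M : VonNeumannAlgebra H) {b : Ell2 H →L[ℂ] Ell2 H}
    (hb : b ∈ scalarOps H) : b ∈ ampAlg M :=
  mem_ampAlg_of_commute fun s _ => scalarOps_commute hb s

/-- The range projection of an element of `M` belongs to `M`. -/
theorem rangeProj_mem {M : VonNeumannAlgebra H} {x : H →L[ℂ] H} (hx : x ∈ M) :
    rangeProj x ∈ projections M := by
  refine starProjection_mem fun s hs =>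
    mem_topologicalClosure_of_forall (Submodule.isClosed_topologicalClosure _) ?_
  rintro _ ⟨ξ, rfl⟩
  refine Submodule.le_topologicalClosure _ ⟨s ξ, ?_⟩
  exact congrArg (fun T : H →L[ℂ] H => T ξ) (VonNeumannAlgebra.mem_commutant_iff.1 hs x hx)

theorem projSup_mem {M : VonNeumannAlgebra H} {S : Set (H →L[ℂ] H)} (hS : ∀ p ∈ S, p ∈ M) :
    projSup S ∈ projections M := by
  refine starProjection_mem fun s hs =>
    mem_topologicalClosure_of_forall (Submodule.isClosed_topologicalClosure _) fun ξ hξ =>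
      Submodule.le_topologicalClosure _ ?_
  have : (⨆ p ∈ S, p.range) ≤ (⨆ p ∈ S, p.range).comap (s : H →ₗ[ℂ] H) := by
    refine iSup₂_le fun p hp => ?_
    rintro _ ⟨η, rfl⟩
    refine Submodule.mem_iSup_of_mem p (Submodule.mem_iSup_of_mem hp ⟨s η, ?_⟩)
    exact congrArg (fun T : H →L[ℂ] H => T η) (VonNeumannAlgebra.mem_commutant_iff.1 hs p (hS p hp))
  exact this hξ

/-- An operator annihilates `⋁ S` from the left as soon as it annihilates all members of `S`. -/
theorem mul_projSup_eq_zero {S : Set (H →L[ℂ] H)} {x : H →L[ℂ] H} (h : ∀ p ∈ S, x * p = 0) :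
    x * projSup S = 0 := by
  have h1 : (⨆ p ∈ S, p.range).topologicalClosure ≤ x.ker := by
    refine Submodule.topologicalClosure_minimal _ (iSup₂_le fun p hp => ?_) x.isClosed_ker
    rintro _ ⟨η, rfl⟩
    exact congrArg (fun T : H →L[ℂ] H => T η) (h p hp)
  ext ξ
  exact h1 (Submodule.starProjection_apply_mem _ ξ)

theorem projSup_mul {S : Set (H →L[ℂ] H)} {p : H →L[ℂ] H} (hp : p ∈ S) : projSup S * p = p := by
  ext ξ
  refine Submodule.starProjection_eq_self_iff.2 (Submodule.le_topologicalClosure _ ?_)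
  exact Submodule.mem_iSup_of_mem p (Submodule.mem_iSup_of_mem hp ⟨ξ, rfl⟩)

theorem rangeProj_mul (x : H →L[ℂ] H) : rangeProj x * x = x := by
  ext ξ
  exact Submodule.starProjection_eq_self_iff.2 (Submodule.le_topologicalClosure _ ⟨ξ, rfl⟩)

theorem mul_rangeProj_eq_zero_iff {x y : H →L[ℂ] H} : x * rangeProj y = 0 ↔ x * y = 0 := by
  constructor
  · intro h
    rw [← rangeProj_mul y, ← mul_assoc, h, zero_mul]
  · intro h
    have h1 : y.range.topologicalClosure ≤ x.ker := by
      refine Submodule.topologicalClosure_minimal _ ?_ x.isClosed_ker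
      rintro _ ⟨η, rfl⟩
      exact congrArg (fun T : H →L[ℂ] H => T η) h
    ext ξ
    exact h1 (Submodule.starProjection_apply_mem _ ξ)

theorem star_projSup (S : Set (H →L[ℂ] H)) : star (projSup S) = projSup S :=
  (isSelfAdjoint_starProjection _).star_eq

theorem star_rangeProj (x : H →L[ℂ] H) : star (rangeProj x) = rangeProj x :=
  (isSelfAdjoint_starProjection _).star_eq

theorem projSup_mul_eq_zero {S : Set (H →L[ℂ] H)} (hS : ∀ p ∈ S, star p = p) {x : H →L[ℂ] H}
    (h : ∀ p ∈ S, p * x = 0) : projSup S * x = 0 := by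
  have := mul_projSup_eq_zero (S := S) (x := star x) fun p hp => by
    rw [← hS p hp, ← star_mul, h p hp, star_zero]
  rw [← star_eq_zero, star_mul, star_projSup, this]

theorem rangeProj_mul_eq_zero_iff {x y : H →L[ℂ] H} : rangeProj x * y = 0 ↔ star x * y = 0 := by
  rw [← star_eq_zero, star_mul, star_rangeProj, mul_rangeProj_eq_zero_iff, ← star_eq_zero,
    star_mul, star_star]

end Projections

/-! ### The weak* topology, and recovering a quantum relation from its intrinsic relation -/

section WeakStar

variable {H : Type*} [NormedAddCommGroup H] [InnerProductSpace ℂ H]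

/-- Presents the topology as induced by a single map into a product, so that basic neighbourhoods
involve finitely many matrix coefficients. -/
theorem weakStar_eq_induced : weakStar H = TopologicalSpace.induced
    (fun (a : H →L[ℂ] H) (v : Ell2 H × Ell2 H) => ⟪v.1, tensorOne a v.2⟫_ℂ) inferInstance := by
  simp only [weakStar, Pi.topologicalSpace, induced_iInf, induced_compose, iInf_prod,
    ← inner_tensorOne]
  rfl

theorem continuous_weakStar_inner (ξ η : Ell2 H) :
    @Continuous _ _ (weakStar H) _ fun a : H →L[ℂ] H => ⟪ξ, tensorOne a η⟫_ℂ := by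
  rw [weakStar_eq_induced]
  let F := fun (a : H →L[ℂ] H) (v : Ell2 H × Ell2 H) => ⟪v.1, tensorOne a v.2⟫_ℂ
  exact @Continuous.comp _ (Ell2 H × Ell2 H → ℂ) ℂ (TopologicalSpace.induced F inferInstance) _ _
    F (fun f => f (ξ, η)) (continuous_apply _) continuous_induced_dom

theorem continuous_weakStar_rng {X : Type*} {t : TopologicalSpace X} {f : X → H →L[ℂ] H}
    (h : ∀ ξ η : Ell2 H, Continuous fun x => ⟪ξ, tensorOne (f x) η⟫_ℂ) :
    @Continuous _ _ t (weakStar H) f := by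
  rw [weakStar_eq_induced]
  exact continuous_induced_rng.2 (continuous_pi fun v => h v.1 v.2)

/-- The vector of `H ⊗ ℓ²` whose even and odd coordinates are those of `ξ` and `η`. -/
noncomputable def interleave (ξ η : Ell2 H) : Ell2 H :=
  ⟨fun n => if Even n then ξ (n / 2) else η (n / 2), by
    refine (memℓp_gen_iff (by norm_num)).2 (Summable.even_add_odd ?_ ?_)
    · simpa using (memℓp_gen_iff (by norm_num)).1 (lp.memℓp ξ)
    · have h : ∀ k, (2 * k + 1) / 2 = k := fun k => by omega
      simpa [h] using (memℓp_gen_iff (by norm_num)).1 (lp.memℓp η)⟩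

theorem interleave_even (ξ η : Ell2 H) (k : ℕ) : interleave ξ η (2 * k) = ξ k := by
  change (if Even (2 * k) then ξ (2 * k / 2) else η (2 * k / 2)) = ξ k
  simp

theorem interleave_odd (ξ η : Ell2 H) (k : ℕ) : interleave ξ η (2 * k + 1) = η k := by
  change (if Even (2 * k + 1) then ξ ((2 * k + 1) / 2) else η ((2 * k + 1) / 2)) = η k
  have h : (2 * k + 1) / 2 = k := by omega
  simp [h]

/-- A sum of two vector functionals of the amplification is again one, because `ℓ²` has room for
both sequences. -/
theorem inner_interleave (ξ ξ' η η' : Ell2 H) (a : H →L[ℂ] H) :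
    ⟪interleave ξ ξ', tensorOne a (interleave η η')⟫_ℂ =
      ⟪ξ, tensorOne a η⟫_ℂ + ⟪ξ', tensorOne a η'⟫_ℂ := by
  refine (lp.hasSum_inner _ _).unique (HasSum.even_add_odd ?_ ?_)
  · simpa only [tensorOne_apply, interleave_even] using lp.hasSum_inner ξ (tensorOne a η)
  · simpa only [tensorOne_apply, interleave_odd] using lp.hasSum_inner ξ' (tensorOne a η')

/-- A finite linear combination of vector functionals of the amplification is one itself. -/
theorem exists_inner_eq_sum {ι : Type*} (s : Finset ι) (c : ι → ℂ) (ξ η : ι → Ell2 H) :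
    ∃ ξ' η' : Ell2 H, ∀ a : H →L[ℂ] H,
      ⟪ξ', tensorOne a η'⟫_ℂ = ∑ i ∈ s, c i * ⟪ξ i, tensorOne a (η i)⟫_ℂ := by
  classical
  induction s using Finset.induction_on with
  | empty => exact ⟨0, 0, fun a => by simp⟩
  | insert i s hi ih =>
    obtain ⟨ξ', η', h⟩ := ih
    -- The coefficient is absorbed into the second vector, where the inner product is linear.
    refine ⟨interleave (ξ i) ξ', interleave (c i • η i) η', fun a => ?_⟩
    rw [inner_interleave, h, Finset.sum_insert hi, map_smul, inner_smul_right]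

/-- An operator outside the weak*-closure of a linear space is separated from it by a vector
functional of the amplification. -/
theorem exists_inner_ne_zero_of_notMem_closure {L : Submodule ℂ (H →L[ℂ] H)} {a : H →L[ℂ] H}
    (ha : a ∉ @closure _ (weakStar H) (L : Set (H →L[ℂ] H))) :
    ∃ ξ η : Ell2 H, (∀ x ∈ L, ⟪ξ, tensorOne x η⟫_ℂ = 0) ∧ ⟪ξ, tensorOne a η⟫_ℂ ≠ 0 := by
  classical
  rw [weakStar_eq_induced, closure_induced, mem_closure_iff] at ha
  push Not at ha
  obtain ⟨o, ho, hao, hLo⟩ := ha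
  obtain ⟨I, u, hu, hIo⟩ := isOpen_pi_iff.1 ho _ hao
  -- Only the finitely many coordinates in `I` matter: `T` records them, and `T a` must miss `T(L)`.
  -- The separation thus takes place in a finite-dimensional space and is pure linear algebra.
  let T : (H →L[ℂ] H) →ₗ[ℂ] (I → ℂ) :=
    { toFun := fun x i => ⟪i.1.1, tensorOne x i.1.2⟫_ℂ
      map_add' := fun x y => by ext i; simp [tensorOne_add]
      map_smul' := fun c x => by ext i; simp [tensorOne_smul] }
  have hT : T a ∉ L.map T := by
    rintro ⟨x, hx, hxa⟩
    have hmem : (fun v : Ell2 H × Ell2 H => ⟪v.1, tensorOne x v.2⟫_ℂ) ∈ o := by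
      refine hIo fun i hi => ?_
      have := congrFun hxa ⟨i, hi⟩
      change ⟪i.1, tensorOne x i.2⟫_ℂ = ⟪i.1, tensorOne a i.2⟫_ℂ at this
      change ⟪i.1, tensorOne x i.2⟫_ℂ ∈ u i
      rw [this]
      exact (hu i hi).2
    have : (fun v : Ell2 H × Ell2 H => ⟪v.1, tensorOne x v.2⟫_ℂ) ∈ o ∩
      ((fun (a : H →L[ℂ] H) (v : Ell2 H × Ell2 H) => ⟪v.1, tensorOne a v.2⟫_ℂ) '' L) :=
        ⟨hmem, x, hx, rfl⟩
    rw [hLo] at this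
    exact this
  obtain ⟨f, hfa, hf⟩ := Submodule.exists_le_ker_of_notMem hT
  obtain ⟨ξ, η, h⟩ := exists_inner_eq_sum Finset.univ (fun i : I => f (Pi.single i 1))
    (fun i => i.1.1) (fun i => i.1.2)
  have h' : ∀ x, ⟪ξ, tensorOne x η⟫_ℂ = f (T x) := fun x => by
    rw [h, LinearMap.pi_apply_eq_sum_univ f (T x)]
    refine Finset.sum_congr rfl fun i _ => ?_
    rw [smul_eq_mul, mul_comm]
    congr 2
    ext j
    simp [Pi.single_apply, eq_comm]
  refine ⟨ξ, η, fun x hx => ?_, by rwa [h']⟩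
  rw [h']
  exact hf ⟨x, hx, rfl⟩

theorem isClosed_weakStarSpan (S : Set (H →L[ℂ] H)) :
    IsClosed[weakStar H] (weakStarSpan S : Set (H →L[ℂ] H)) := by
  rw [weakStarSpan, Submodule.coe_sInf]
  exact @isClosed_biInter _ _ (weakStar H) _ _ fun W hW => hW.1

theorem subset_weakStarSpan (S : Set (H →L[ℂ] H)) : S ⊆ weakStarSpan S := by
  intro x hx
  rw [SetLike.mem_coe, weakStarSpan, Submodule.mem_sInf]
  exact fun W hW => hW.2 hx

theorem weakStarSpan_le {S : Set (H →L[ℂ] H)} {W : Submodule ℂ (H →L[ℂ] H)}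
    (hW : IsClosed[weakStar H] (W : Set (H →L[ℂ] H))) (h : S ⊆ W) : weakStarSpan S ≤ W :=
  sInf_le ⟨hW, h⟩

variable [CompleteSpace H]

theorem continuous_weakStar_mul_left (s : H →L[ℂ] H) :
    @Continuous _ _ (weakStar H) (weakStar H) fun a : H →L[ℂ] H => s * a := by
  refine continuous_weakStar_rng fun ξ η => ?_
  have h : (fun a : H →L[ℂ] H => ⟪ξ, tensorOne (s * a) η⟫_ℂ) =
      fun a => ⟪star (tensorOne s) ξ, tensorOne a η⟫_ℂ := by
    ext a
    rw [inner_star_left]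
    rfl
  rw [h]
  exact continuous_weakStar_inner _ _

theorem continuous_weakStar_mul_right (s : H →L[ℂ] H) :
    @Continuous _ _ (weakStar H) (weakStar H) fun a : H →L[ℂ] H => a * s :=
  continuous_weakStar_rng fun ξ η => continuous_weakStar_inner ξ (tensorOne s η)

/-- The operators `a` with `x (a ⊗ 1) y = 0` form a weak*-closed linear space. -/
def annihilated (x y : Ell2 H →L[ℂ] Ell2 H) : Submodule ℂ (H →L[ℂ] H) where
  carrier := {a | x * tensorOne a * y = 0}
  add_mem' := fun {a b} ha hb => by
    change x * tensorOne (a + b) * y = 0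
    rw [tensorOne_add, mul_add, add_mul, show x * tensorOne a * y = 0 from ha,
      show x * tensorOne b * y = 0 from hb, add_zero]
  zero_mem' := by
    change x * tensorOne 0 * y = 0
    rw [tensorOne_zero, mul_zero, zero_mul]
  smul_mem' := fun c a ha => by
    change x * tensorOne (c • a) * y = 0
    rw [tensorOne_smul, mul_smul_comm, smul_mul_assoc, show x * tensorOne a * y = 0 from ha,
      smul_zero]

theorem mem_annihilated {x y : Ell2 H →L[ℂ] Ell2 H} {a : H →L[ℂ] H} :
    a ∈ annihilated x y ↔ x * tensorOne a * y = 0 := Iff.rfl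

theorem isClosed_annihilated (x y : Ell2 H →L[ℂ] Ell2 H) :
    IsClosed[weakStar H] (annihilated x y : Set (H →L[ℂ] H)) := by
  have h : (annihilated x y : Set (H →L[ℂ] H)) =
      ⋂ (ξ : Ell2 H) (η : Ell2 H), (fun a => ⟪star x ξ, tensorOne a (y η)⟫_ℂ) ⁻¹' {0} := by
    ext a
    simp only [Set.mem_iInter, Set.mem_preimage, Set.mem_singleton_iff, SetLike.mem_coe,
      mem_annihilated, inner_star_left]
    constructor
    · intro h ξ η
      change ⟪ξ, (x * tensorOne a * y) η⟫_ℂ = 0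
      rw [h]
      simp
    · intro h
      ext1 η
      exact ext_inner_left ℂ fun ξ => by
        rw [zero_apply, inner_zero_right]
        exact h ξ η
  rw [h]
  refine @isClosed_iInter _ _ (weakStar H) _ fun ξ =>
    @isClosed_iInter _ _ (weakStar H) _ fun η => ?_
  exact @IsClosed.preimage _ _ (weakStar H) _ _ (continuous_weakStar_inner _ _) _ isClosed_singleton

/-- The operators annihilated between `x` and `y` form a weak*-closed linear space, so membership in
`R_V` can be tested on generators of `V`. -/
theorem exists_mem_weakStarSpan_iff {S : Set (H →L[ℂ] H)} {x y : Ell2 H →L[ℂ] Ell2 H} :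
    (∃ a ∈ weakStarSpan S, x * tensorOne a * y ≠ 0) ↔ ∃ a ∈ S, x * tensorOne a * y ≠ 0 := by
  refine ⟨fun h => ?_, fun ⟨a, ha, h⟩ => ⟨a, subset_weakStarSpan S ha, h⟩⟩
  by_contra! h'
  obtain ⟨a, ha, hne⟩ := h
  exact hne (weakStarSpan_le (isClosed_annihilated x y) h' ha)

/-- The weak*-closed span of an `M'`-`M'`-invariant set is a quantum relation. -/
theorem isQuantumRelation_weakStarSpan {M : VonNeumannAlgebra H} {S : Set (H →L[ℂ] H)}
    (hl : ∀ s ∈ M.commutant, ∀ a ∈ S, s * a ∈ S) (hr : ∀ s ∈ M.commutant, ∀ a ∈ S, a * s ∈ S) :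
    IsQuantumRelation M (weakStarSpan S) where
  isClosed := isClosed_weakStarSpan S
  left_mem := fun s hs a ha => by
    have : weakStarSpan S ≤ (weakStarSpan S).comap (LinearMap.mulLeft ℂ s) :=
      weakStarSpan_le (@IsClosed.preimage _ _ (weakStar H) (weakStar H) _
        (continuous_weakStar_mul_left s) _ (isClosed_weakStarSpan S))
        fun a ha => subset_weakStarSpan S (hl s hs a ha)
    exact this ha
  right_mem := fun s hs a ha => by
    have : weakStarSpan S ≤ (weakStarSpan S).comap (LinearMap.mulRight ℂ s) :=
      weakStarSpan_le (@IsClosed.preimage _ _ (weakStar H) (weakStar H) _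
        (continuous_weakStar_mul_right s) _ (isClosed_weakStarSpan S))
        fun a ha => subset_weakStarSpan S (hr s hs a ha)
    exact this ha

/-- The closed subspace of `H ⊗ ℓ²` generated by a vector under the action of `L ⊗ 1`. -/
noncomputable def cyclic (L : Submodule ℂ (H →L[ℂ] H)) (η : Ell2 H) : Submodule ℂ (Ell2 H) :=
  Submodule.topologicalClosure
    { carrier := {ζ | ∃ x ∈ L, tensorOne x η = ζ}
      add_mem' := by
        rintro _ _ ⟨x, hx, rfl⟩ ⟨y, hy, rfl⟩
        exact ⟨x + y, add_mem hx hy, rfl⟩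
      zero_mem' := ⟨0, zero_mem L, rfl⟩
      smul_mem' := by
        rintro c _ ⟨x, hx, rfl⟩
        exact ⟨c • x, L.smul_mem c hx, rfl⟩ }

theorem tensorOne_mem_cyclic {L : Submodule ℂ (H →L[ℂ] H)} {x : H →L[ℂ] H} (hx : x ∈ L)
    (η : Ell2 H) : tensorOne x η ∈ cyclic L η :=
  Submodule.le_topologicalClosure _ ⟨x, hx, rfl⟩

instance (L : Submodule ℂ (H →L[ℂ] H)) (η : Ell2 H) : (cyclic L η).HasOrthogonalProjection :=
  inferInstanceAs (Submodule.topologicalClosure _).HasOrthogonalProjection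

theorem cyclic_le {L : Submodule ℂ (H →L[ℂ] H)} {η : Ell2 H} {W : Submodule ℂ (Ell2 H)}
    (hW : IsClosed (W : Set (Ell2 H))) (h : ∀ x ∈ L, tensorOne x η ∈ W) : cyclic L η ≤ W :=
  Submodule.topologicalClosure_minimal _ (by rintro _ ⟨x, hx, rfl⟩; exact h x hx) hW

theorem isClosed_cyclic (L : Submodule ℂ (H →L[ℂ] H)) (η : Ell2 H) :
    IsClosed (cyclic L η : Set (Ell2 H)) :=
  Submodule.isClosed_topologicalClosure _

theorem cyclic_invariant {L : Submodule ℂ (H →L[ℂ] H)} {s : H →L[ℂ] H}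
    (hs : ∀ x ∈ L, s * x ∈ L) (η : Ell2 H) : ∀ ζ ∈ cyclic L η, tensorOne s ζ ∈ cyclic L η :=
  mem_topologicalClosure_of_forall (isClosed_cyclic L η) (by
    rintro _ ⟨x, hx, rfl⟩
    exact tensorOne_mem_cyclic (hs x hx) η)

theorem cyclic_commutant_mem (M : VonNeumannAlgebra H) (η : Ell2 H) :
    (cyclic (commutantSpace M) η).starProjection ∈ projections (ampAlg M) :=
  starProjection_mem_ampAlg fun s hs => cyclic_invariant
    (fun x (hx : x ∈ M.commutant) => show s * x ∈ M.commutant from mul_mem hs hx) η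

theorem cyclic_commutant_apply (M : VonNeumannAlgebra H) (η : Ell2 H) :
    (cyclic (commutantSpace M) η).starProjection η = η :=
  Submodule.starProjection_eq_self_iff.2
    (tensorOne_mem_cyclic (L := commutantSpace M) (one_mem M.commutant) η)

/-- A quantum relation is determined by its intrinsic quantum relation. -/
theorem mem_of_intrinsic {M : VonNeumannAlgebra H} {V : Submodule ℂ (H →L[ℂ] H)}
    (hV : IsQuantumRelation M V) {a : H →L[ℂ] H}
    (h : ∀ p ∈ projections (ampAlg M), ∀ q ∈ projections (ampAlg M),
      p * tensorOne a * q ≠ 0 → (p, q) ∈ intrinsic M V) : a ∈ V := by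
  by_contra ha
  obtain ⟨ξ, η, hξη, hne⟩ := exists_inner_ne_zero_of_notMem_closure (L := V) (a := a) (by
    rwa [@IsClosed.closure_eq _ (weakStar H) _ hV.isClosed])
  -- The projections onto the closures of `(M' ⊗ 1) ξ` and `(M' ⊗ 1) η`. They lie in `M ⊗̄ B(ℓ²)`
  -- and fix `ξ`, `η`, so `p (a ⊗ 1) q ≠ 0`.
  set p := (cyclic (commutantSpace M) ξ).starProjection with hp
  set q := (cyclic (commutantSpace M) η).starProjection with hq
  have hpm : p ∈ projections (ampAlg M) := cyclic_commutant_mem M ξ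
  have hqm : q ∈ projections (ampAlg M) := cyclic_commutant_mem M η
  obtain ⟨-, -, v, hv, hpvq⟩ := h p hpm q hqm fun h0 => hne (by
    have h1 : ⟪ξ, (p * tensorOne a * q) η⟫_ℂ = 0 := by rw [h0]; simp
    change ⟪ξ, p (tensorOne a (q η))⟫_ℂ = 0 at h1
    rwa [hq, cyclic_commutant_apply, ← inner_star_left, hpm.2.2.star_eq, hp,
      cyclic_commutant_apply] at h1)
  apply hpvq
  -- The bimodule property enters here: `⟪(s ⊗ 1) ξ, (v t ⊗ 1) η⟫` is the separating functional at
  -- `s* v t ∈ V`, hence zero. Continuity extends this to the closures, giving `p (v ⊗ 1) q = 0`.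
  have key : ∀ ζ ∈ cyclic (commutantSpace M) η, ∀ ω ∈ cyclic (commutantSpace M) ξ,
      ⟪ω, tensorOne v ζ⟫_ℂ = 0 := by
    intro ζ hζ ω hω
    have h1 : cyclic (commutantSpace M) η ≤
        ((ℂ ∙ ω)ᗮ).comap (tensorOne v : Ell2 H →ₗ[ℂ] Ell2 H) := by
      refine cyclic_le ((Submodule.isClosed_orthogonal _).preimage (tensorOne v).continuous)
        fun t ht => ?_
      rw [Submodule.mem_comap, Submodule.mem_orthogonal_singleton_iff_inner_right]
      have h2 : cyclic (commutantSpace M) ξ ≤ (ℂ ∙ (tensorOne v (tensorOne t η)))ᗮ := by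
        refine cyclic_le (Submodule.isClosed_orthogonal _) fun s hs => ?_
        rw [Submodule.mem_orthogonal_singleton_iff_inner_left, ← inner_star_right, star_tensorOne]
        exact hξη _ (hV.left_mem _ (star_mem (show s ∈ M.commutant from hs)) _ (hV.right_mem t ht v hv))
      exact (Submodule.mem_orthogonal_singleton_iff_inner_left).1 (h2 hω)
    exact (Submodule.mem_orthogonal_singleton_iff_inner_right).1 (h1 hζ)
  ext1 ζ
  refine ext_inner_left ℂ fun ω => ?_
  rw [zero_apply, inner_zero_right]
  change ⟪ω, p (tensorOne v (q ζ))⟫_ℂ = 0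
  rw [← inner_star_left, hpm.2.2.star_eq]
  exact key _ (Submodule.starProjection_apply_mem _ _) _ (Submodule.starProjection_apply_mem _ _)

end WeakStar

/-! ### Weak*-closed left ideals -/

section LeftIdeals

variable {H : Type*} [NormedAddCommGroup H] [InnerProductSpace ℂ H] [CompleteSpace H]

/-- The common kernel of a set of operators. -/
def commonKernel (L : Set (H →L[ℂ] H)) : Submodule ℂ H := ⨅ x ∈ L, x.ker

theorem mem_commonKernel {L : Set (H →L[ℂ] H)} {ξ : H} :
    ξ ∈ commonKernel L ↔ ∀ x ∈ L, x ξ = 0 := by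
  simp [commonKernel, Submodule.mem_iInf]

theorem isClosed_commonKernel (L : Set (H →L[ℂ] H)) : IsClosed (commonKernel L : Set H) := by
  simp only [commonKernel, Submodule.coe_iInf]
  exact isClosed_iInter fun x => isClosed_iInter fun _ => x.isClosed_ker

instance (L : Set (H →L[ℂ] H)) : (commonKernel L).HasOrthogonalProjection :=
  have : CompleteSpace (commonKernel L) := (isClosed_commonKernel L).completeSpace_coe
  inferInstance

theorem commonKernel_mem {M : VonNeumannAlgebra H} {L : Set (H →L[ℂ] H)} (hL : ∀ x ∈ L, x ∈ M) :
    (commonKernel L).starProjection ∈ projections M := by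
  refine starProjection_mem fun s hs ξ hξ => mem_commonKernel.2 fun x hx => ?_
  have h : x * s = s * x := VonNeumannAlgebra.mem_commutant_iff.1 hs x (hL x hx)
  change (x * s) ξ = 0
  rw [h]
  change s (x ξ) = 0
  rw [mem_commonKernel.1 hξ x hx, map_zero]

/-- The weak*-closure of a left ideal of `M` contains the projection onto the orthogonal complement
of its common kernel. -/
theorem one_sub_commonKernel_mem_closure {M : VonNeumannAlgebra H}
    {L : Submodule ℂ (H →L[ℂ] H)} (hLM : ∀ x ∈ L, x ∈ M) (hL : ∀ s ∈ M, ∀ x ∈ L, s * x ∈ L) :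
    1 - (commonKernel (L : Set (H →L[ℂ] H))).starProjection ∈
      @closure _ (weakStar H) (L : Set (H →L[ℂ] H)) := by
  by_contra hcl
  obtain ⟨ξ, η, hξ, hne⟩ := exists_inner_ne_zero_of_notMem_closure hcl
  set z := (commonKernel (L : Set (H →L[ℂ] H))).starProjection with hz
  have hzM : z ∈ M := (commonKernel_mem hLM).1
  set e := (cyclic L η).starProjection with he
  -- The closure of `(L ⊗ 1) η` is invariant under `M ⊗ 1`, hence reduces it. Therefore `(x ⊗ 1) e η
  -- = e (x ⊗ 1) η = (x ⊗ 1) η`, so that `η - e η` has all its coordinates in the common kernel.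
  have hcomm : ∀ x ∈ L, tensorOne x * e = e * tensorOne x := fun x hx =>
    commute_starProjection (cyclic_invariant (hL x (hLM x hx)) η)
      (by rw [star_tensorOne]; exact cyclic_invariant (hL _ (star_mem (hLM x hx))) η)
  have h1 : ∀ x ∈ L, tensorOne x (η - e η) = 0 := fun x hx => by
    have h2 : tensorOne x (e η) = e (tensorOne x η) :=
      congrArg (fun T : Ell2 H →L[ℂ] Ell2 H => T η) (hcomm x hx)
    rw [map_sub, h2, Submodule.starProjection_eq_self_iff.2 (tensorOne_mem_cyclic hx η), sub_self]
  have h2 : tensorOne (1 - z) (η - e η) = 0 := by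
    ext n
    have h3 : (η - e η) n ∈ commonKernel (L : Set (H →L[ℂ] H)) := mem_commonKernel.2 fun x hx =>
      congrArg (fun ζ : Ell2 H => ζ n) (h1 x hx)
    rw [tensorOne_apply, sub_apply, hz,
      Submodule.starProjection_eq_self_iff.2 h3]
    simp
  -- Thus `((1 - z) ⊗ 1) η = ((1 - z) ⊗ 1) e η` stays in the cyclic space, which is orthogonal to
  -- `ξ`; this contradicts the separation.
  have h3 : tensorOne (1 - z) η ∈ cyclic L η := by
    rw [map_sub, sub_eq_zero] at h2
    rw [h2]
    exact cyclic_invariant (hL _ (sub_mem (one_mem M) hzM)) η _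
      (Submodule.starProjection_apply_mem _ _)
  have h4 : cyclic L η ≤ (ℂ ∙ ξ)ᗮ := cyclic_le (Submodule.isClosed_orthogonal _) fun x hx =>
    Submodule.mem_orthogonal_singleton_iff_inner_right.2 (hξ x hx)
  exact hne (Submodule.mem_orthogonal_singleton_iff_inner_right.1 (h4 h3))

/-- A weak*-closed left ideal of `M` contains the projection onto the orthogonal complement of its
common kernel. -/
theorem exists_projection_of_leftIdeal {M : VonNeumannAlgebra H}
    {I : Submodule ℂ M.toStarSubalgebra}
    (hcl : IsClosed[TopologicalSpace.induced Subtype.val (weakStar H)] (I : Set M.toStarSubalgebra))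
    (hI : ∀ s, ∀ x ∈ I, s * x ∈ I) :
    ∃ z : M.toStarSubalgebra, IsStarProjection (z : H →L[ℂ] H) ∧
      (∀ x ∈ I, (x : H →L[ℂ] H) * z = 0) ∧ 1 - z ∈ I := by
  let L : Submodule ℂ (H →L[ℂ] H) := I.map M.toStarSubalgebra.subtype.toAlgHom.toLinearMap
  have hLmem : ∀ x, x ∈ L ↔ ∃ y ∈ I, (y : H →L[ℂ] H) = x := fun x => Iff.rfl
  have hLM : ∀ x ∈ L, x ∈ M := by
    rintro _ ⟨y, -, rfl⟩
    exact y.2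
  have hL : ∀ s ∈ M, ∀ x ∈ L, s * x ∈ L := by
    rintro s hs _ ⟨y, hy, rfl⟩
    exact ⟨⟨s, hs⟩ * y, hI ⟨s, hs⟩ y hy, rfl⟩
  have hz := commonKernel_mem (L := (L : Set (H →L[ℂ] H))) hLM
  refine ⟨⟨_, hz.1⟩, hz.2, fun x hx => ?_, ?_⟩
  · ext ξ
    exact mem_commonKernel.1 (Submodule.starProjection_apply_mem
      (commonKernel (L : Set (H →L[ℂ] H))) ξ) x ⟨x, hx, rfl⟩
  · obtain ⟨C, hC, hCI⟩ := (@isClosed_induced_iff _ _ (weakStar H) _ _).1 hcl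
    have h1 : @closure _ (weakStar H) (L : Set (H →L[ℂ] H)) ⊆ C := by
      refine @closure_minimal _ (weakStar H) _ _ ?_ hC
      rintro _ ⟨y, hy, rfl⟩
      have : y ∈ Subtype.val ⁻¹' C := by rw [hCI]; exact hy
      exact this
    rw [← SetLike.mem_coe, ← hCI]
    exact h1 (one_sub_commonKernel_mem_closure hLM hL)

end LeftIdeals

/-! ### Supports of quantum functions and preservation of joins -/

namespace QuantumFunction

variable {H : Type*} [NormedAddCommGroup H] [InnerProductSpace ℂ H] [CompleteSpace H]
variable {K : Type*} [NormedAddCommGroup K] [InnerProductSpace ℂ K] [CompleteSpace K]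
variable {M : VonNeumannAlgebra H} {N : VonNeumannAlgebra K}

/-- Weak*-continuity of `φ` is used through this coefficient, obtained by placing `u` and `v` in
coordinate `0` of `K ⊗ ℓ²`. -/
theorem continuous_inner (φ : QuantumFunction M N) (u v : K) :
    @Continuous _ _ (TopologicalSpace.induced Subtype.val (weakStar H)) _
      fun x : M.toStarSubalgebra => ⟪u, (φ.toHom x : K →L[ℂ] K) v⟫_ℂ := by
  have h1 := @Continuous.comp _ _ _ (TopologicalSpace.induced Subtype.val (weakStar H))
      (TopologicalSpace.induced Subtype.val (weakStar K)) (weakStar K) _ _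
      (@continuous_induced_dom _ _ _ (weakStar K)) φ.continuous_weakStar
  have h2 := @Continuous.comp _ _ _ (TopologicalSpace.induced Subtype.val (weakStar H))
    (weakStar K) _ _ _ (continuous_weakStar_inner (lp.single 2 0 u) (lp.single 2 0 v)) h1
  have h3 : ((fun a : K →L[ℂ] K => ⟪(lp.single 2 0 u : Ell2 K), tensorOne a (lp.single 2 0 v)⟫_ℂ) ∘
      Subtype.val ∘ φ.toHom) = fun x : M.toStarSubalgebra =>
        ⟪u, (φ.toHom x : K →L[ℂ] K) v⟫_ℂ := by
    ext x
    change ⟪(lp.single 2 0 u : Ell2 K), tensorOne (φ.toHom x : K →L[ℂ] K) (lp.single 2 0 v)⟫_ℂ = _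
    rw [tensorOne_single, lp.inner_single_left]
    simp
  rw [h3] at h2
  exact h2

/-- The elements `x` of `M` such that `φ(x)` vanishes on the given set of vectors. -/
def annihilator (φ : QuantumFunction M N) (S : Set K) : Submodule ℂ M.toStarSubalgebra where
  carrier := {x | ∀ v ∈ S, (φ.toHom x : K →L[ℂ] K) v = 0}
  add_mem' := fun {x y} hx hy v hv => by
    rw [map_add]
    change (φ.toHom x : K →L[ℂ] K) v + (φ.toHom y : K →L[ℂ] K) v = 0
    rw [hx v hv, hy v hv, add_zero]
  zero_mem' := fun v _ => by rw [map_zero]; rfl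
  smul_mem' := fun c x hx v hv => by
    rw [map_smul]
    change c • (φ.toHom x : K →L[ℂ] K) v = 0
    rw [hx v hv, smul_zero]

theorem mem_annihilator {φ : QuantumFunction M N} {S : Set K} {x : M.toStarSubalgebra} :
    x ∈ φ.annihilator S ↔ ∀ v ∈ S, (φ.toHom x : K →L[ℂ] K) v = 0 := Iff.rfl

theorem isClosed_annihilator (φ : QuantumFunction M N) (S : Set K) :
    IsClosed[TopologicalSpace.induced Subtype.val (weakStar H)]
      (φ.annihilator S : Set M.toStarSubalgebra) := by
  have h : (φ.annihilator S : Set M.toStarSubalgebra) = ⋂ v ∈ S, ⋂ u : K,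
      (fun x : M.toStarSubalgebra => ⟪u, (φ.toHom x : K →L[ℂ] K) v⟫_ℂ) ⁻¹' {0} := by
    ext x
    simp only [Set.mem_iInter, Set.mem_preimage, Set.mem_singleton_iff, SetLike.mem_coe,
      mem_annihilator]
    refine forall₂_congr fun v _ => ⟨fun h u => by rw [h, inner_zero_right], fun h => ?_⟩
    exact ext_inner_left ℂ fun u => by rw [h u, inner_zero_right]
  let _ : TopologicalSpace M.toStarSubalgebra :=
    TopologicalSpace.induced Subtype.val (weakStar H)
  rw [h]
  exact isClosed_biInter fun v _ => isClosed_iInter fun u =>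
    isClosed_singleton.preimage (φ.continuous_inner u v)

/-- With `S` the whole space this yields the support of `φ`; with `S` a single vector it yields the
preservation of joins. -/
theorem exists_projection_annihilator (φ : QuantumFunction M N) (S : Set K) :
    ∃ z : M.toStarSubalgebra, IsStarProjection (z : H →L[ℂ] H) ∧
      (∀ x ∈ φ.annihilator S, (x : H →L[ℂ] H) * z = 0) ∧ 1 - z ∈ φ.annihilator S :=
  exists_projection_of_leftIdeal (φ.isClosed_annihilator S) fun s x hx v hv => by
    rw [map_mul]
    change (φ.toHom s : K →L[ℂ] K) ((φ.toHom x : K →L[ℂ] K) v) = 0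
    rw [hx v hv, map_zero]

/-- The kernel of a quantum function is of the form `M (1 - z)` for a projection `z` of `M`. -/
theorem exists_support (φ : QuantumFunction M N) :
    ∃ z : M.toStarSubalgebra, IsStarProjection (z : H →L[ℂ] H) ∧ φ.toHom z = 1 ∧
      ∀ x, φ.toHom x = 0 → x * z = 0 := by
  obtain ⟨z, hz, h1, h2⟩ := φ.exists_projection_annihilator Set.univ
  refine ⟨z, hz, ?_, fun x hx => Subtype.ext (h1 x fun v _ => by rw [hx]; rfl)⟩
  have h3 : φ.toHom (1 - z) = 0 := Subtype.ext (ContinuousLinearMap.ext fun v => h2 v trivial)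
  rw [map_sub, map_one, sub_eq_zero] at h3
  exact h3.symm

/-- The images under `φ` of the operators in `P` that belong to `M`. -/
def imageSet (φ : QuantumFunction M N) (P : Set (H →L[ℂ] H)) : Set (K →L[ℂ] K) :=
  {y | ∃ x : M.toStarSubalgebra, (x : H →L[ℂ] H) ∈ P ∧ (φ.toHom x : K →L[ℂ] K) = y}

theorem isStarProjection_toHom (φ : QuantumFunction M N) {p : M.toStarSubalgebra}
    (hp : IsStarProjection (p : H →L[ℂ] H)) : IsStarProjection (φ.toHom p : K →L[ℂ] K) := by
  have h1 : p * p = p := Subtype.ext hp.1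
  have h2 : star p = p := Subtype.ext hp.2
  constructor
  · change ((φ.toHom p * φ.toHom p : N.toStarSubalgebra) : K →L[ℂ] K) = _
    rw [← map_mul, h1]
  · change ((star (φ.toHom p) : N.toStarSubalgebra) : K →L[ℂ] K) = _
    rw [← map_star, h2]

theorem imageSet_subset (φ : QuantumFunction M N) {P : Set (H →L[ℂ] H)} (hP : P ⊆ projections M) :
    φ.imageSet P ⊆ projections N := by
  rintro _ ⟨p, hp, rfl⟩
  exact ⟨(φ.toHom p).2, φ.isStarProjection_toHom (hP hp).2⟩

theorem imageSet_iUnion (φ : QuantumFunction M N) {ι : Type*} (P : ι → Set (H →L[ℂ] H)) :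
    φ.imageSet (⋃ i, P i) = ⋃ i, φ.imageSet (P i) := by
  ext y
  simp only [imageSet, Set.mem_ofPred_eq, Set.mem_iUnion]
  constructor
  · rintro ⟨x, ⟨i, hi⟩, h⟩
    exact ⟨i, x, hi, h⟩
  · rintro ⟨i, x, hi, h⟩
    exact ⟨x, ⟨i, hi⟩, h⟩

/-- A quantum function maps a family of projections with join `1` to one with join `1`. -/
theorem projSup_imageSet (φ : QuantumFunction M N) {P : Set (H →L[ℂ] H)}
    (hP : P ⊆ projections M) (h : projSup P = 1) : projSup (φ.imageSet P) = 1 := by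
  have h1 : (⨆ y ∈ φ.imageSet P, y.range).topologicalClosure = ⊤ := by
    rw [Submodule.topologicalClosure_eq_top_iff, eq_bot_iff]
    intro v hv
    -- Since `v` is orthogonal to the ranges of the `φ(p)`, every `p ∈ P` lies in the left ideal
    -- annihilating `v`. Hence `p z = 0` for all `p`, so `z = 0`, and `1` annihilates `v`.
    obtain ⟨z, hz, hz1, hz2⟩ := φ.exists_projection_annihilator {v}
    have h2 : ∀ p ∈ P, p * (z : H →L[ℂ] H) = 0 := fun p hp => by
      refine hz1 ⟨p, (hP hp).1⟩ ?_
      rintro w rfl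
      refine ext_inner_left ℂ fun u => ?_
      have hsa := (φ.isStarProjection_toHom (p := ⟨p, (hP hp).1⟩) (hP hp).2).2.star_eq
      rw [inner_zero_right, ← inner_star_left, hsa]
      refine (Submodule.mem_orthogonal _ _).1 hv _ ?_
      exact Submodule.mem_iSup_of_mem _ (Submodule.mem_iSup_of_mem ⟨⟨p, (hP hp).1⟩, hp, rfl⟩
        ⟨u, rfl⟩)
    have h3 : (z : H →L[ℂ] H) = 0 := by
      have := projSup_mul_eq_zero (fun p hp => (hP hp).2.2.star_eq) h2
      rwa [h, one_mul] at this
    have h4 : z = 0 := Subtype.ext h3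
    have := hz2 v rfl
    rw [h4, sub_zero, map_one] at this
    exact this
  ext v
  refine Submodule.starProjection_eq_self_iff.2 ?_
  rw [h1]
  trivial

end QuantumFunction

/-! ### Separation by scalar matrices, and their transfer between Hilbert spaces -/

section ScalarOps

variable {H : Type*} [NormedAddCommGroup H] [InnerProductSpace ℂ H] [CompleteSpace H]
variable {K : Type*} [NormedAddCommGroup K] [InnerProductSpace ℂ K] [CompleteSpace K]

/-- If `x (B(H) ⊗ 1) y = 0`, then `x` and `y` are separated by a projection of `1 ⊗ B(ℓ²)`. -/
theorem exists_scalarOps_separating {x y : Ell2 H →L[ℂ] Ell2 H}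
    (h : ∀ a : H →L[ℂ] H, x * tensorOne a * y = 0) :
    ∃ b ∈ scalarOps H, x * b = 0 ∧ b * y = y := by
  -- The separating projection is the one onto the closed span of `(B(H) ⊗ 1) y (H ⊗ ℓ²)`.
  -- Invariance under `B(H) ⊗ 1` puts it in `1 ⊗ B(ℓ²)`, and `a = 1` shows that it fixes the range
  -- of `y`.
  let S : Set (Ell2 H →L[ℂ] Ell2 H) := Set.range fun a : H →L[ℂ] H => tensorOne a * y
  have hinv : ∀ a : H →L[ℂ] H, ∀ ξ ∈ (⨆ p ∈ S, p.range).topologicalClosure,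
      tensorOne a ξ ∈ (⨆ p ∈ S, p.range).topologicalClosure := fun a =>
    mem_topologicalClosure_of_forall (Submodule.isClosed_topologicalClosure _) fun ξ hξ =>
      Submodule.le_topologicalClosure _ (by
        have : (⨆ p ∈ S, p.range) ≤
            (⨆ p ∈ S, p.range).comap (tensorOne a : Ell2 H →ₗ[ℂ] Ell2 H) := by
          refine iSup₂_le ?_
          rintro _ ⟨c, rfl⟩ _ ⟨η, rfl⟩
          exact Submodule.mem_iSup_of_mem _ (Submodule.mem_iSup_of_mem ⟨a * c, rfl⟩ ⟨η, rfl⟩)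
        exact this hξ)
  refine ⟨projSup S, mem_scalarOps_of_commute fun a => ?_, ?_, projSup_mul ⟨1, ?_⟩⟩
  · exact commute_starProjection (hinv a) (by rw [star_tensorOne]; exact hinv _)
  · refine mul_projSup_eq_zero ?_
    rintro _ ⟨a, rfl⟩
    change x * (tensorOne a * y) = 0
    rw [← mul_assoc, h]
  · change tensorOne 1 * y = y
    rw [tensorOne_one, one_mul]

/-- The von Neumann algebra of scalars on `H`. -/
noncomputable def scalarAlg (H : Type*) [NormedAddCommGroup H] [InnerProductSpace ℂ H]
    [CompleteSpace H] : VonNeumannAlgebra H where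
  toStarSubalgebra := StarSubalgebra.centralizer ℂ Set.univ
  centralizer_centralizer' := by
    simpa using Set.centralizer_centralizer_centralizer (Set.univ : Set (H →L[ℂ] H))

theorem exists_eq_smul_one (x : (scalarAlg H).toStarSubalgebra) : ∃ c : ℂ, x = c • 1 := by
  have h : (x : H →L[ℂ] H) ∈ Subalgebra.center ℂ (H →L[ℂ] H) := by
    rw [Subalgebra.mem_center_iff]
    intro a
    exact (StarSubalgebra.mem_centralizer_iff ℂ |>.1 x.2 a trivial).1
  rw [Algebra.IsCentral.center_eq_bot] at h
  obtain ⟨c, hc⟩ := Algebra.mem_bot.1 h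
  refine ⟨c, Subtype.ext ?_⟩
  rw [← hc, Algebra.algebraMap_eq_smul_one]
  rfl

/-- The isomorphism between the scalars on `K` and on `H`, given by a unit vector of `K`. -/
noncomputable def scalarHom (H : Type*) [NormedAddCommGroup H] [InnerProductSpace ℂ H]
    [CompleteSpace H] (u : K) (hu : ‖u‖ = 1) :
    (scalarAlg K).toStarSubalgebra →⋆ₐ[ℂ] (scalarAlg H).toStarSubalgebra :=
  have key : ∀ c : ℂ, ⟪u, ((c • (1 : (scalarAlg K).toStarSubalgebra) :
      (scalarAlg K).toStarSubalgebra) : K →L[ℂ] K) u⟫_ℂ = c := fun c => by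
    change ⟪u, c • u⟫_ℂ = c
    rw [inner_smul_right, inner_self_eq_norm_sq_to_K, hu]
    simp
  { toFun := fun x => ⟪u, (x : K →L[ℂ] K) u⟫_ℂ • 1
    map_one' := by
      have := key 1
      rw [one_smul] at this
      rw [this, one_smul]
    map_mul' := fun x y => by
      obtain ⟨c, rfl⟩ := exists_eq_smul_one x
      obtain ⟨d, rfl⟩ := exists_eq_smul_one y
      rw [smul_mul_smul_comm, one_mul, key, key, key, smul_mul_smul_comm, one_mul]
    map_zero' := by
      have := key 0
      rw [zero_smul] at this
      rw [this, zero_smul]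
    map_add' := fun x y => by
      obtain ⟨c, rfl⟩ := exists_eq_smul_one x
      obtain ⟨d, rfl⟩ := exists_eq_smul_one y
      rw [← add_smul, key, key, key, add_smul]
    commutes' := fun c => by
      rw [Algebra.algebraMap_eq_smul_one, key, Algebra.algebraMap_eq_smul_one]
    map_star' := fun x => by
      obtain ⟨c, rfl⟩ := exists_eq_smul_one x
      rw [star_smul, star_one, key, key, star_smul, star_one] }

theorem scalarHom_smul_one (u : K) (hu : ‖u‖ = 1) (c : ℂ) :
    scalarHom H u hu (c • 1) = c • 1 := by
  rw [map_smul, map_one]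

/-- The scalar matrices that define bounded operators on `K ⊗ ℓ²` define bounded operators on
`H ⊗ ℓ²`. -/
theorem exists_scalarOps_transfer (H : Type*) [NormedAddCommGroup H] [InnerProductSpace ℂ H]
    [CompleteSpace H] {b : Ell2 K →L[ℂ] Ell2 K} (hb : b ∈ scalarOps K) :
    ∃ b' : Ell2 H →L[ℂ] Ell2 H, ∀ i j, ∃ c : ℂ,
      entry b i j = c • (1 : K →L[ℂ] K) ∧ entry b' i j = c • (1 : H →L[ℂ] H) := by
  -- On `K = 0` the entries do not determine their scalars, and all of them can be taken to be `0`.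
  -- Otherwise boundedness on `H ⊗ ℓ²` comes from amplifying the isomorphism between the two copies
  -- of the scalars.
  rcases subsingleton_or_nontrivial K with hK | hK
  · exact ⟨0, fun i j => ⟨0, Subsingleton.elim _ _, by rw [entry_zero, zero_smul]⟩⟩
  · obtain ⟨u, hu⟩ := exists_norm_eq K zero_le_one
    refine ⟨amplify (scalarHom H u hu) ⟨b, scalarOps_subset_ampAlg _ hb⟩, fun i j => ?_⟩
    obtain ⟨c, hc⟩ := hb i j
    refine ⟨c, hc, ?_⟩
    rw [entry_amplify]
    have : (⟨entry b i j, mem_ampAlg_iff.1 (scalarOps_subset_ampAlg _ hb) i j⟩ :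
        (scalarAlg K).toStarSubalgebra) = c • 1 := Subtype.ext hc
    rw [this, scalarHom_smul_one]
    rfl

end ScalarOps

/-! ### Algebraic properties of `φ ⊗ 1` -/

section Amplify

variable {H : Type*} [NormedAddCommGroup H] [InnerProductSpace ℂ H] [CompleteSpace H]
variable {K : Type*} [NormedAddCommGroup K] [InnerProductSpace ℂ K] [CompleteSpace K]
variable {M : VonNeumannAlgebra H} {N : VonNeumannAlgebra K}

theorem amplify_mem (φ : M.toStarSubalgebra →⋆ₐ[ℂ] N.toStarSubalgebra) (x : ampAlg M) :
    amplify φ x ∈ ampAlg N := by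
  rw [mem_ampAlg_iff]
  intro i j
  rw [entry_amplify]
  exact Subtype.prop _

theorem eq_amplify {φ : M.toStarSubalgebra →⋆ₐ[ℂ] N.toStarSubalgebra} {x : ampAlg M}
    {y : Ell2 K →L[ℂ] Ell2 K}
    (h : ∀ i j, entry y i j = φ ⟨entry x.1 i j, mem_ampAlg_iff.1 x.2 i j⟩) : y = amplify φ x :=
  entry_ext fun i j => by rw [h, entry_amplify]

theorem amplify_tensorOne (φ : M.toStarSubalgebra →⋆ₐ[ℂ] N.toStarSubalgebra)
    (a : M.toStarSubalgebra) (h : tensorOne (a : H →L[ℂ] H) ∈ ampAlg M) :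
    amplify φ ⟨tensorOne (a : H →L[ℂ] H), h⟩ = tensorOne (φ a : K →L[ℂ] K) := by
  refine (eq_amplify fun i j => ?_).symm
  simp only [entry_tensorOne]
  by_cases hij : i = j
  · simp [hij]
  · simp only [hij, if_false]
    have : (⟨0, zero_mem _⟩ : M.toStarSubalgebra) = 0 := rfl
    rw [this, map_zero]
    rfl

theorem amplify_star (φ : M.toStarSubalgebra →⋆ₐ[ℂ] N.toStarSubalgebra) {x : Ell2 H →L[ℂ] Ell2 H}
    (hx : x ∈ ampAlg M) (h : star x ∈ ampAlg M) :
    amplify φ ⟨star x, h⟩ = star (amplify φ ⟨x, hx⟩) := by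
  refine (eq_amplify fun i j => ?_).symm
  rw [entry_star, entry_amplify]
  have : (⟨entry (star x) i j, mem_ampAlg_iff.1 h i j⟩ : M.toStarSubalgebra) =
    star ⟨entry x j i, mem_ampAlg_iff.1 hx j i⟩ := Subtype.ext (entry_star x i j)
  rw [this, map_star]
  rfl

theorem amplify_sub (φ : M.toStarSubalgebra →⋆ₐ[ℂ] N.toStarSubalgebra) {x y : Ell2 H →L[ℂ] Ell2 H}
    (hx : x ∈ ampAlg M) (hy : y ∈ ampAlg M) (h : x - y ∈ ampAlg M) :
    amplify φ ⟨x - y, h⟩ = amplify φ ⟨x, hx⟩ - amplify φ ⟨y, hy⟩ := by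
  refine (eq_amplify fun i j => ?_).symm
  rw [entry_sub, entry_amplify, entry_amplify]
  have : (⟨entry (x - y) i j, mem_ampAlg_iff.1 h i j⟩ : M.toStarSubalgebra) =
    ⟨entry x i j, mem_ampAlg_iff.1 hx i j⟩ - ⟨entry y i j, mem_ampAlg_iff.1 hy i j⟩ :=
      Subtype.ext (entry_sub x y i j)
  rw [this, map_sub]
  rfl

theorem amplify_one (φ : M.toStarSubalgebra →⋆ₐ[ℂ] N.toStarSubalgebra)
    (h : (1 : Ell2 H →L[ℂ] Ell2 H) ∈ ampAlg M) : amplify φ ⟨1, h⟩ = 1 := by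
  have := amplify_tensorOne φ 1 h
  rw [map_one] at this
  exact this

theorem amplify_eq_of_scalars (φ : M.toStarSubalgebra →⋆ₐ[ℂ] N.toStarSubalgebra)
    {b : Ell2 K →L[ℂ] Ell2 K} {b' : Ell2 H →L[ℂ] Ell2 H} (hb' : b' ∈ ampAlg M)
    (h : ∀ i j, ∃ c : ℂ, entry b i j = c • (1 : K →L[ℂ] K) ∧
      entry b' i j = c • (1 : H →L[ℂ] H)) : amplify φ ⟨b', hb'⟩ = b := by
  refine (eq_amplify fun i j => ?_).symm
  obtain ⟨c, hc, hc'⟩ := h i j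
  have : (⟨entry b' i j, mem_ampAlg_iff.1 hb' i j⟩ : M.toStarSubalgebra) = c • 1 :=
    Subtype.ext hc'
  rw [hc, this, map_smul, map_one]
  rfl

theorem amplify_mem_scalarOps (φ : M.toStarSubalgebra →⋆ₐ[ℂ] N.toStarSubalgebra)
    {b : Ell2 H →L[ℂ] Ell2 H} (hb : b ∈ scalarOps H) (h : b ∈ ampAlg M) :
    amplify φ ⟨b, h⟩ ∈ scalarOps K := by
  intro i j
  obtain ⟨c, hc⟩ := hb i j
  refine ⟨c, ?_⟩
  have : (⟨entry b i j, mem_ampAlg_iff.1 h i j⟩ : M.toStarSubalgebra) = c • 1 := Subtype.ext hc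
  rw [entry_amplify, this, map_smul, map_one]
  rfl

theorem amplify_amplify {L : Type*} [NormedAddCommGroup L] [InnerProductSpace ℂ L]
    [CompleteSpace L] {O : VonNeumannAlgebra L}
    (φ : M.toStarSubalgebra →⋆ₐ[ℂ] N.toStarSubalgebra)
    (ψ : N.toStarSubalgebra →⋆ₐ[ℂ] O.toStarSubalgebra) (x : ampAlg M)
    (h : amplify φ x ∈ ampAlg N) :
    amplify ψ ⟨amplify φ x, h⟩ = amplify (ψ.comp φ) x := by
  refine eq_amplify fun i j => ?_
  rw [entry_amplify]
  have : (⟨entry (amplify φ x) i j, mem_ampAlg_iff.1 h i j⟩ : N.toStarSubalgebra) =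
    φ ⟨entry x.1 i j, mem_ampAlg_iff.1 x.2 i j⟩ := Subtype.ext (entry_amplify φ x i j)
  rw [this]
  rfl

theorem amplify_id (x : ampAlg M) : amplify (StarAlgHom.id ℂ M.toStarSubalgebra) x = x.1 :=
  (eq_amplify fun _ _ => rfl).symm

/-- The column `y (v ⊗ δⱼ)` is the norm limit of its truncations, so the infinite matrix product
converges strongly. -/
theorem tendsto_entry_mul (x y : Ell2 H →L[ℂ] Ell2 H) (i j : ℕ) (v : H) :
    Filter.Tendsto (fun m => (∑ k ∈ Finset.range m, entry x i k * entry y k j) v) Filter.atTop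
      (𝓝 (entry (x * y) i j v)) := by
  have h1 := (lp.hasSum_single (p := 2) (by norm_num) (y (lp.single 2 j v))).mapL
    ((coord H i).comp x)
  refine h1.tendsto_sum_nat.congr fun m => ?_
  rw [sum_apply]
  rfl

end Amplify

/-! ### Normality and multiplicativity of the amplification -/

namespace QuantumFunction

variable {H : Type*} [NormedAddCommGroup H] [InnerProductSpace ℂ H] [CompleteSpace H]
variable {K : Type*} [NormedAddCommGroup K] [InnerProductSpace ℂ K] [CompleteSpace K]
variable {M : VonNeumannAlgebra H} {N : VonNeumannAlgebra K}

/-- A strongly convergent sequence is weak*-convergent. -/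
theorem tendsto_inner_tensorOne {S : ℕ → H →L[ℂ] H} {T : H →L[ℂ] H}
    (h : ∀ v, Filter.Tendsto (fun m => S m v) Filter.atTop (𝓝 (T v))) (ξ η : Ell2 H) :
    Filter.Tendsto (fun m => ⟪ξ, tensorOne (S m) η⟫_ℂ) Filter.atTop
      (𝓝 ⟪ξ, tensorOne T η⟫_ℂ) := by
  -- A uniform norm bound is needed to dominate the infinite sum over coordinates; strong
  -- convergence controls each term only.
  obtain ⟨C, hC⟩ := banach_steinhaus (g := S) fun v => by
    obtain ⟨C, hC⟩ := (Metric.isBounded_range_of_tendsto _ (h v)).exists_norm_le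
    exact ⟨C, fun m => hC _ ⟨m, rfl⟩⟩
  simp only [inner_tensorOne]
  refine tendsto_tsum_of_dominated_convergence
    (bound := fun n => C * (‖ξ n‖ ^ 2 + ‖η n‖ ^ 2)) ?_ ?_ ?_
  · refine Summable.mul_left C (Summable.add ?_ ?_)
    · simpa using (memℓp_gen_iff (by norm_num)).1 (lp.memℓp ξ)
    · simpa using (memℓp_gen_iff (by norm_num)).1 (lp.memℓp η)
  · exact fun n => tendsto_const_nhds.inner (h (η n))
  · refine Filter.Eventually.of_forall fun m n => ?_
    have hC0 : 0 ≤ C := (norm_nonneg _).trans (hC m)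
    calc ‖⟪ξ n, S m (η n)⟫_ℂ‖ ≤ ‖ξ n‖ * ‖S m (η n)‖ := norm_inner_le_norm _ _
      _ ≤ ‖ξ n‖ * (C * ‖η n‖) := by gcongr; exact (S m).le_of_opNorm_le (hC m) _
      _ = C * (‖ξ n‖ * ‖η n‖) := by ring
      _ ≤ C * (‖ξ n‖ ^ 2 + ‖η n‖ ^ 2) := by
        gcongr
        nlinarith [sq_nonneg (‖ξ n‖ - ‖η n‖), sq_nonneg ‖ξ n‖, sq_nonneg ‖η n‖]

theorem tendsto_inner (φ : QuantumFunction M N) {S : ℕ → M.toStarSubalgebra}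
    {T : M.toStarSubalgebra}
    (h : ∀ v, Filter.Tendsto (fun m => (S m : H →L[ℂ] H) v) Filter.atTop
      (𝓝 ((T : H →L[ℂ] H) v))) (u v : K) :
    Filter.Tendsto (fun m => ⟪u, (φ.toHom (S m) : K →L[ℂ] K) v⟫_ℂ) Filter.atTop
      (𝓝 ⟪u, (φ.toHom T : K →L[ℂ] K) v⟫_ℂ) := by
  have hST : Filter.Tendsto S Filter.atTop
      (@nhds _ (TopologicalSpace.induced Subtype.val (weakStar H)) T) := by
    rw [weakStar_eq_induced, induced_compose, nhds_induced, Filter.tendsto_comap_iff,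
      tendsto_pi_nhds]
    exact fun w => tendsto_inner_tensorOne h w.1 w.2
  have h1 := @Continuous.tendsto _ _ (_) _ _ (φ.continuous_inner u v) T
  exact h1.comp hST

/-- The amplification of a quantum function is multiplicative. -/
theorem amplify_mul (φ : QuantumFunction M N) {x y : Ell2 H →L[ℂ] Ell2 H} (hx : x ∈ ampAlg M)
    (hy : y ∈ ampAlg M) (h : x * y ∈ ampAlg M) :
    amplify φ.toHom ⟨x * y, h⟩ = amplify φ.toHom ⟨x, hx⟩ * amplify φ.toHom ⟨y, hy⟩ := by
  refine (eq_amplify fun i j => ?_).symm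
  let X : ℕ → M.toStarSubalgebra := fun k => ⟨entry x i k, mem_ampAlg_iff.1 hx i k⟩
  let Y : ℕ → M.toStarSubalgebra := fun k => ⟨entry y k j, mem_ampAlg_iff.1 hy k j⟩
  ext1 v
  refine ext_inner_left ℂ fun u => ?_
  -- The entry of `x y` is a strong limit of finite sums in `M`, so normality of `φ` gives weak
  -- convergence of the images. The same images are the partial sums for the product of the
  -- amplifications, and limits are unique.
  have h1 : Filter.Tendsto
      (fun m => ⟪u, (φ.toHom (∑ k ∈ Finset.range m, X k * Y k) : K →L[ℂ] K) v⟫_ℂ)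
      Filter.atTop
      (𝓝 ⟪u, (φ.toHom ⟨entry (x * y) i j, mem_ampAlg_iff.1 h i j⟩ : K →L[ℂ] K) v⟫_ℂ) := by
    refine φ.tendsto_inner (fun w => (tendsto_entry_mul x y i j w).congr fun m => ?_) u v
    rw [AddSubmonoidClass.coe_finsetSum]
    rfl
  have h2 := (tendsto_const_nhds (x := u)).inner (𝕜 := ℂ)
    (tendsto_entry_mul (amplify φ.toHom ⟨x, hx⟩) (amplify φ.toHom ⟨y, hy⟩) i j v)
  refine tendsto_nhds_unique h2 (h1.congr fun m => ?_)
  rw [map_sum, AddSubmonoidClass.coe_finsetSum]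
  have h3 : ∀ k ∈ Finset.range m, ((φ.toHom (X k * Y k) : N.toStarSubalgebra) : K →L[ℂ] K) =
      entry (amplify φ.toHom ⟨x, hx⟩) i k * entry (amplify φ.toHom ⟨y, hy⟩) k j := fun k _ => by
    rw [entry_amplify, entry_amplify, map_mul]
    rfl
  rw [Finset.sum_congr rfl h3]

theorem amplify_mem_projections (φ : QuantumFunction M N) {p : Ell2 H →L[ℂ] Ell2 H}
    (hp : p ∈ projections (ampAlg M)) :
    amplify φ.toHom ⟨p, hp.1⟩ ∈ projections (ampAlg N) := by
  refine ⟨amplify_mem _ _, ?_, ?_⟩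
  · change _ * _ = _
    rw [← φ.amplify_mul hp.1 hp.1 (mul_mem hp.1 hp.1)]
    congr 2
    exact hp.2.1
  · change star _ = _
    rw [← amplify_star _ hp.1 (star_mem hp.1)]
    congr 2
    exact hp.2.2

end QuantumFunction

/-! ### `R_V` is an intrinsic quantum relation -/

section Intrinsic

variable {H : Type*} [NormedAddCommGroup H] [InnerProductSpace ℂ H] [CompleteSpace H]

/-- On the set of projections the weak operator topology is the strong one. -/
theorem continuous_apply_starProjection (ξ : H) :
    Continuous fun p : {p : H →WOT[ℂ] H // IsStarProjection p.toCLM} => p.1 ξ := by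
  have hin : ∀ w : H, Continuous fun p : {p : H →WOT[ℂ] H // IsStarProjection p.toCLM} =>
      ⟪w, p.1 ξ⟫_ℂ := fun w =>
    (ContinuousLinearMapWOT.continuous_dual_apply ξ (innerSL ℂ w)).comp continuous_subtype_val
  refine continuous_iff_continuousAt.2 fun p₀ => ?_
  rw [ContinuousAt, tendsto_iff_norm_sub_tendsto_zero]
  -- This is `‖p ξ - p₀ ξ‖²` expanded, with `‖p ξ‖²` rewritten as `⟪ξ, p ξ⟫`; in this form it is
  -- visibly continuous for the weak operator topology.
  let g : {p : H →WOT[ℂ] H // IsStarProjection p.toCLM} → ℝ := fun p =>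
    Complex.re ⟪ξ, p.1 ξ⟫_ℂ - 2 * Complex.re ⟪p₀.1 ξ, p.1 ξ⟫_ℂ + ‖p₀.1 ξ‖ ^ 2
  have hnorm : ∀ p : {p : H →WOT[ℂ] H // IsStarProjection p.toCLM},
      Complex.re ⟪ξ, p.1 ξ⟫_ℂ = ‖p.1 ξ‖ ^ 2 := fun p => by
    have h1 : ⟪ξ, p.1 ξ⟫_ℂ = ⟪p.1 ξ, p.1 ξ⟫_ℂ := by
      have h2 : p.1 (p.1 ξ) = p.1 ξ := congrArg (fun T : H →L[ℂ] H => T ξ) p.2.1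
      have h3 : ⟪p.1.toCLM ξ, p.1.toCLM ξ⟫_ℂ = ⟪ξ, p.1.toCLM (p.1.toCLM ξ)⟫_ℂ := by
        have h4 := inner_star_left p.1.toCLM ξ (p.1.toCLM ξ)
        rwa [p.2.2.star_eq] at h4
      exact ((congrArg (fun w => ⟪ξ, w⟫_ℂ) h2).symm.trans h3.symm)
    rw [h1]
    exact (norm_sq_eq_re_inner (𝕜 := ℂ) (p.1 ξ)).symm
  have hg : ∀ p, ‖p.1 ξ - p₀.1 ξ‖ = Real.sqrt (g p) := fun p => by
    rw [← Real.sqrt_sq (norm_nonneg (p.1 ξ - p₀.1 ξ)), norm_sub_rev, norm_sub_sq (𝕜 := ℂ)]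
    congr 1
    simp only [g, hnorm, RCLike.re_eq_complex_re]
    ring
  have hgc : Continuous g :=
    ((Complex.continuous_re.comp (hin ξ)).sub
      (continuous_const.mul (Complex.continuous_re.comp (hin (p₀.1 ξ))))).add continuous_const
  have h0 : Real.sqrt (g p₀) = 0 := by rw [← hg, sub_self, norm_zero]
  have := (Real.continuous_sqrt.comp hgc).tendsto p₀
  rw [Function.comp_apply, h0] at this
  exact this.congr fun p => (hg p).symm

theorem mul_mul_ne_zero_iff {p q x : H →L[ℂ] H} (hp : IsStarProjection p) :
    p * x * q ≠ 0 ↔ ∃ ξ η : H, ⟪p ξ, x (q η)⟫_ℂ ≠ 0 := by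
  have h : ∀ ξ η : H, ⟪p ξ, x (q η)⟫_ℂ = ⟪ξ, (p * x * q) η⟫_ℂ := fun ξ η => by
    rw [← inner_star_right, hp.2.star_eq]
    rfl
  constructor
  · intro hne
    by_contra! h0
    refine hne (ContinuousLinearMap.ext fun η => ext_inner_left ℂ fun ξ => ?_)
    rw [← h, h0, zero_apply, inner_zero_right]
  · rintro ⟨ξ, η, hne⟩ h0
    rw [h, h0, zero_apply, inner_zero_right] at hne
    exact hne rfl

/-- Openness rests on the joint continuity of `⟪p ξ, (a ⊗ 1) q η⟫`, available because the weak and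
strong operator topologies agree on projections. The join axiom is linearity and continuity, and the
range axiom holds because `b` commutes with `a ⊗ 1`. -/
theorem isIntrinsicQuantumRelation_intrinsic (M : VonNeumannAlgebra H)
    (V : Submodule ℂ (H →L[ℂ] H)) : IsIntrinsicQuantumRelation M (intrinsic M V) where
  subset := fun _ h => ⟨h.1, h.2.1⟩
  isOpen := by
    let X := {p : Ell2 H →WOT[ℂ] Ell2 H // IsStarProjection p.toCLM}
    let O : Set (X × X) := ⋃ (a ∈ V) (ξ : Ell2 H) (η : Ell2 H),
      {pq | ⟪pq.1.1 ξ, tensorOne a (pq.2.1 η)⟫_ℂ ≠ 0}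
    have hO : IsOpen O := by
      refine isOpen_biUnion fun a _ => isOpen_iUnion fun ξ => isOpen_iUnion fun η => ?_
      refine isOpen_ne_fun ?_ continuous_const
      exact ((continuous_apply_starProjection ξ).comp continuous_fst).inner
        ((tensorOne a).continuous.comp ((continuous_apply_starProjection η).comp continuous_snd))
    have hind : Topology.IsInducing (Prod.map (Subtype.val : X → _) (Subtype.val : X → _)) :=
      Topology.IsInducing.subtypeVal.prodMap Topology.IsInducing.subtypeVal
    obtain ⟨U, hU, hUO⟩ := hind.isOpen_iff.1 hO
    refine ⟨U, hU, fun p hp q hq => ?_⟩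
    have h1 : ((ContinuousLinearMapWOT.ofCLM p, ContinuousLinearMapWOT.ofCLM q) ∈ U) ↔
        ((⟨ContinuousLinearMapWOT.ofCLM p, hp.2⟩, ⟨ContinuousLinearMapWOT.ofCLM q, hq.2⟩) :
          X × X) ∈ O := by
      rw [← hUO]
      rfl
    rw [h1]
    simp only [O, Set.mem_iUnion, exists_prop]
    constructor
    · rintro ⟨-, -, a, ha, hne⟩
      exact ⟨a, ha, (mul_mul_ne_zero_iff hp.2).1 hne⟩
    · rintro ⟨a, ha, hne⟩
      exact ⟨hp, hq, a, ha, (mul_mul_ne_zero_iff hp.2).2 hne⟩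
  zero_notMem := by
    rintro ⟨-, -, a, -, h⟩
    exact h (by rw [mul_zero])
  sup_mem_iff := fun S hS T hT _ _ => by
    have hpS := projSup_mem (M := ampAlg M) fun p hp => (hS hp).1
    have hpT := projSup_mem (M := ampAlg M) fun p hp => (hT hp).1
    constructor
    · rintro ⟨-, -, a, ha, hne⟩
      by_contra! h
      refine hne (mul_projSup_eq_zero fun q hq => ?_)
      rw [mul_assoc]
      refine projSup_mul_eq_zero (fun p hp => (hS hp).2.2.star_eq) fun p hp => ?_
      by_contra h0
      exact h p hp q hq ⟨hS hp, hT hq, a, ha, by rwa [mul_assoc]⟩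
    · rintro ⟨p, hp, q, hq, -, -, a, ha, hne⟩
      refine ⟨hpS, hpT, a, ha, fun h0 => hne ?_⟩
      have h1 : p * projSup S = p := by
        rw [← (hS hp).2.2.star_eq, ← star_projSup, ← star_mul,
          (hS hp).2.2.star_eq, projSup_mul hp, (hS hp).2.2.star_eq]
      have h2 : p * tensorOne a * q = p * (projSup S * tensorOne a * projSup T) * q := by
        conv_lhs => rw [← h1, ← projSup_mul hq]
        simp only [mul_assoc]
      change p * tensorOne a * q = 0
      rw [h2, h0, mul_zero, zero_mul]
  range_mem_iff := fun p hp q hq b hb => by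
    have hbM : b ∈ ampAlg M := scalarOps_subset_ampAlg M hb
    have h1 : rangeProj (b * q) ∈ projections (ampAlg M) := rangeProj_mem (mul_mem hbM hq.1)
    have h2 : rangeProj (star b * p) ∈ projections (ampAlg M) :=
      rangeProj_mem (mul_mem (star_mem hbM) hp.1)
    have key : ∀ a : H →L[ℂ] H, p * tensorOne a * rangeProj (b * q) = 0 ↔
        rangeProj (star b * p) * tensorOne a * q = 0 := fun a => by
      rw [mul_rangeProj_eq_zero_iff, mul_assoc (rangeProj _), rangeProj_mul_eq_zero_iff, star_mul,
        star_star, hp.2.2.star_eq, mul_assoc p, ← mul_assoc (tensorOne a), scalarOps_commute hb]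
      simp only [mul_assoc]
    constructor
    · rintro ⟨-, -, a, ha, hne⟩
      exact ⟨h2, hq, a, ha, fun h => hne ((key a).2 h)⟩
    · rintro ⟨-, -, a, ha, hne⟩
      exact ⟨hp, h1, a, ha, fun h => hne ((key a).1 h)⟩

end Intrinsic

/-! ### Quantum relations generated by sandwiches -/

section Sandwich

variable {H : Type*} [NormedAddCommGroup H] [InnerProductSpace ℂ H] [CompleteSpace H]

/-- The operators `l a r` with `(l, r) ∈ S` and `a ∈ B(H)`. -/
def sandwich (S : Set ((H →L[ℂ] H) × (H →L[ℂ] H))) : Set (H →L[ℂ] H) :=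
  {x | ∃ lr ∈ S, ∃ a : H →L[ℂ] H, x = lr.1 * a * lr.2}

/-- Elements of `M'` move past `l, r ∈ M` and are absorbed into the arbitrary middle operator. -/
theorem isQuantumRelation_sandwich {M : VonNeumannAlgebra H}
    {S : Set ((H →L[ℂ] H) × (H →L[ℂ] H))} (hS : ∀ lr ∈ S, lr.1 ∈ M ∧ lr.2 ∈ M) :
    IsQuantumRelation M (weakStarSpan (sandwich S)) := by
  refine isQuantumRelation_weakStarSpan ?_ ?_
  · rintro s hs _ ⟨lr, hlr, a, rfl⟩
    refine ⟨lr, hlr, s * a, ?_⟩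
    simp only [← mul_assoc]
    rw [VonNeumannAlgebra.mem_commutant_iff.1 hs _ (hS lr hlr).1]
  · rintro s hs _ ⟨lr, hlr, a, rfl⟩
    refine ⟨lr, hlr, a * s, ?_⟩
    simp only [mul_assoc]
    rw [VonNeumannAlgebra.mem_commutant_iff.1 hs _ (hS lr hlr).2]

end Sandwich

/-! ### Pulling back generated relations along a quantum function -/

namespace QuantumFunction

variable {H : Type*} [NormedAddCommGroup H] [InnerProductSpace ℂ H] [CompleteSpace H]
variable {K : Type*} [NormedAddCommGroup K] [InnerProductSpace ℂ K] [CompleteSpace K]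
variable {M : VonNeumannAlgebra H} {N : VonNeumannAlgebra K}

/-- The separating relations `x b = 0` and `b y = y` are preserved by `φ ⊗ 1`, and the image of `b`
is again a scalar matrix, hence commutes with `B(K) ⊗ 1`. -/
theorem amplify_mul_tensorOne_mul_eq_zero (φ : QuantumFunction M N) {x y : Ell2 H →L[ℂ] Ell2 H}
    (hx : x ∈ ampAlg M) (hy : y ∈ ampAlg M) (h : ∀ a : H →L[ℂ] H, x * tensorOne a * y = 0)
    (a : K →L[ℂ] K) :
    amplify φ.toHom ⟨x, hx⟩ * tensorOne a * amplify φ.toHom ⟨y, hy⟩ = 0 := by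
  obtain ⟨b, hb, hxb, hby⟩ := exists_scalarOps_separating h
  have hbM : b ∈ ampAlg M := scalarOps_subset_ampAlg M hb
  have h1 : amplify φ.toHom ⟨x, hx⟩ * amplify φ.toHom ⟨b, hbM⟩ = 0 := by
    rw [← φ.amplify_mul hx hbM (mul_mem hx hbM)]
    refine (eq_amplify fun i j => ?_).symm
    have : (⟨entry (x * b) i j, mem_ampAlg_iff.1 (mul_mem hx hbM) i j⟩ : M.toStarSubalgebra) =
      0 := Subtype.ext ((congrArg (entry · i j) hxb).trans (entry_zero i j))
    rw [entry_zero, this, map_zero]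
    rfl
  have h2 : amplify φ.toHom ⟨b, hbM⟩ * amplify φ.toHom ⟨y, hy⟩ = amplify φ.toHom ⟨y, hy⟩ := by
    rw [← φ.amplify_mul hbM hy (mul_mem hbM hy)]
    congr 2
  rw [← h2, mul_assoc, ← mul_assoc (tensorOne a),
    scalarOps_commute (amplify_mem_scalarOps φ.toHom hb hbM), ← mul_assoc, ← mul_assoc, h1,
    zero_mul, zero_mul]

section Support

variable {φ : QuantumFunction M N} {z : M.toStarSubalgebra}

theorem mul_tensorOne_support_eq_zero (hz : ∀ x, φ.toHom x = 0 → x * z = 0)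
    {w : Ell2 H →L[ℂ] Ell2 H} (hw : w ∈ ampAlg M) (h : amplify φ.toHom ⟨w, hw⟩ = 0) :
    w * tensorOne (z : H →L[ℂ] H) = 0 := by
  refine entry_ext fun i j => ?_
  rw [entry_mul_tensorOne, entry_zero]
  refine congrArg Subtype.val (hz ⟨entry w i j, mem_ampAlg_iff.1 hw i j⟩ (Subtype.ext ?_))
  rw [← entry_amplify φ.toHom ⟨w, hw⟩ i j, h, entry_zero]
  rfl

/-- Taking adjoints moves `z` to the other side, without appealing to its centrality. -/
theorem tensorOne_support_mul_eq_zero (hzp : IsStarProjection (z : H →L[ℂ] H))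
    (hz : ∀ x, φ.toHom x = 0 → x * z = 0) {w : Ell2 H →L[ℂ] Ell2 H} (hw : w ∈ ampAlg M)
    (h : amplify φ.toHom ⟨w, hw⟩ = 0) : tensorOne (z : H →L[ℂ] H) * w = 0 := by
  have h1 := mul_tensorOne_support_eq_zero hz (star_mem hw)
    (by rw [amplify_star _ hw, h, star_zero])
  rw [← star_eq_zero, star_mul, star_tensorOne, hzp.2.star_eq, h1]

/-- If `z` is the support of `φ`, then `(φ ⊗ 1)(x) (B(K) ⊗ 1) (φ ⊗ 1)(y)` vanishes if and only if
`x (z B(H) z ⊗ 1) y` does. -/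
theorem amplify_mul_tensorOne_mul_eq_zero_iff (hzp : IsStarProjection (z : H →L[ℂ] H))
    (hz1 : φ.toHom z = 1) (hz : ∀ x, φ.toHom x = 0 → x * z = 0) {x y : Ell2 H →L[ℂ] Ell2 H}
    (hx : x ∈ ampAlg M) (hy : y ∈ ampAlg M) :
    (∀ a : K →L[ℂ] K, amplify φ.toHom ⟨x, hx⟩ * tensorOne a * amplify φ.toHom ⟨y, hy⟩ = 0) ↔
      ∀ a : H →L[ℂ] H, x * tensorOne ((z : H →L[ℂ] H) * a * (z : H →L[ℂ] H)) * y = 0 := by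
  have hzM : tensorOne (z : H →L[ℂ] H) ∈ ampAlg M := tensorOne_mem_ampAlg z.2
  constructor
  · intro h a
    obtain ⟨b, hb, hxb, hby⟩ := exists_scalarOps_separating h
    -- The separating matrix found over `K` is read over `H`. Since `φ ⊗ 1` sends `b'` to `b`, it
    -- kills `x b'` and `y - b' y`, so these vanish after multiplication by `z ⊗ 1`.
    obtain ⟨b', hb'⟩ := exists_scalarOps_transfer H hb
    have hb's : b' ∈ scalarOps H := fun i j => ⟨_, (hb' i j).choose_spec.2⟩
    have hbM : b' ∈ ampAlg M := scalarOps_subset_ampAlg M hb's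
    have hamp : amplify φ.toHom ⟨b', hbM⟩ = b := amplify_eq_of_scalars φ.toHom hbM hb'
    have h1 : x * b' * tensorOne (z : H →L[ℂ] H) = 0 :=
      mul_tensorOne_support_eq_zero hz (mul_mem hx hbM) (by rw [φ.amplify_mul hx hbM, hamp, hxb])
    have h2 : tensorOne (z : H →L[ℂ] H) * (y - b' * y) = 0 :=
      tensorOne_support_mul_eq_zero hzp hz (sub_mem hy (mul_mem hbM hy))
        (by rw [amplify_sub _ hy (mul_mem hbM hy), φ.amplify_mul hbM hy, hamp, hby, sub_self])
    rw [mul_sub, sub_eq_zero] at h2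
    have h3 : tensorOne ((z : H →L[ℂ] H) * a * (z : H →L[ℂ] H)) * y =
        b' * (tensorOne ((z : H →L[ℂ] H) * a * (z : H →L[ℂ] H)) * y) := by
      conv_lhs => rw [tensorOne_mul, mul_assoc, h2, ← mul_assoc, ← tensorOne_mul,
        ← mul_assoc, scalarOps_commute hb's, mul_assoc]
    rw [mul_assoc, h3, ← mul_assoc, tensorOne_mul, tensorOne_mul]
    simp only [← mul_assoc]
    rw [h1]
    simp only [zero_mul]
  · intro h a
    -- Applied to `x (z ⊗ 1)` and `(z ⊗ 1) y`; the extra factors disappear because `φ(z) = 1`.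
    have h1 := φ.amplify_mul_tensorOne_mul_eq_zero (mul_mem hx hzM) (mul_mem hzM hy)
      (fun a => by
        have := h a
        rw [tensorOne_mul, tensorOne_mul] at this
        simpa only [mul_assoc] using this) a
    rw [φ.amplify_mul hx hzM, φ.amplify_mul hzM hy, amplify_tensorOne, hz1] at h1
    have h2 : tensorOne ((1 : N.toStarSubalgebra) : K →L[ℂ] K) = 1 := tensorOne_one
    rwa [h2, mul_one, one_mul] at h1

/-- The pullback of the intrinsic quantum relation spanned by the `φ(r) B(K) φ(r)`, `r ∈ P`. -/
theorem pullback_intrinsic_sandwich (hzp : IsStarProjection (z : H →L[ℂ] H))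
    (hz1 : φ.toHom z = 1) (hz : ∀ x, φ.toHom x = 0 → x * z = 0) {P : Set (H →L[ℂ] H)}
    (hP : P ⊆ projections M) :
    φ.pullback (intrinsic N (weakStarSpan (sandwich ((fun y => (y, y)) '' φ.imageSet P)))) =
      intrinsic M (weakStarSpan (sandwich ((fun r => (r * (z : H →L[ℂ] H), (z : H →L[ℂ] H) * r)) '' P))) := by
  -- The support criterion with `x = p (r ⊗ 1)` and `y = (r ⊗ 1) q`.
  have key : ∀ p q (hp : p ∈ projections (ampAlg M)) (hq : q ∈ projections (ampAlg M))
      (r : M.toStarSubalgebra),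
      (∀ a : K →L[ℂ] K, amplify φ.toHom ⟨p, hp.1⟩ *
        tensorOne ((φ.toHom r : K →L[ℂ] K) * a * (φ.toHom r : K →L[ℂ] K)) * amplify φ.toHom ⟨q, hq.1⟩ = 0) ↔
      ∀ a : H →L[ℂ] H,
        p * tensorOne ((r : H →L[ℂ] H) * (z : H →L[ℂ] H) * a * ((z : H →L[ℂ] H) * (r : H →L[ℂ] H))) * q = 0 := by
    intro p q hp hq r
    have hr : tensorOne (r : H →L[ℂ] H) ∈ ampAlg M := tensorOne_mem_ampAlg r.2
    have h := amplify_mul_tensorOne_mul_eq_zero_iff hzp hz1 hz (mul_mem hp.1 hr) (mul_mem hr hq.1)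
    rw [φ.amplify_mul hp.1 hr, φ.amplify_mul hr hq.1, amplify_tensorOne] at h
    simpa only [tensorOne_mul, mul_assoc] using h
  ext ⟨p, q⟩
  constructor
  · rintro ⟨hp, hq, -, -, h⟩
    refine ⟨hp, hq, exists_mem_weakStarSpan_iff.2 ?_⟩
    obtain ⟨_, ⟨_, ⟨_, ⟨r, hr, rfl⟩, rfl⟩, a, rfl⟩, hne⟩ := exists_mem_weakStarSpan_iff.1 h
    by_contra! h0
    exact hne ((key p q hp hq r).2
      (fun a => h0 _ ⟨_, ⟨(r : H →L[ℂ] H), hr, rfl⟩, a, rfl⟩) a)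
  · rintro ⟨hp, hq, h⟩
    refine ⟨hp, hq, φ.amplify_mem_projections hp, φ.amplify_mem_projections hq,
      exists_mem_weakStarSpan_iff.2 ?_⟩
    obtain ⟨_, ⟨_, ⟨r, hr, rfl⟩, a, rfl⟩, hne⟩ := exists_mem_weakStarSpan_iff.1 h
    by_contra! h0
    exact hne ((key p q hp hq ⟨r, (hP hr).1⟩).1
      (fun a => h0 _ ⟨_, ⟨_, ⟨⟨r, (hP hr).1⟩, hr, rfl⟩, rfl⟩, a, rfl⟩) a)

end Support

/-! ### Monotonicity of asymptotic dimension -/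

/-- The expansion property restricted to the intrinsic quantum relations of quantum relations. -/
def ExpandsQuantumRelations (φ : QuantumFunction M N) (𝒱 : Set (Submodule ℂ (H →L[ℂ] H)))
    (𝒰 : Set (Submodule ℂ (K →L[ℂ] K))) : Prop :=
  ∀ W, IsQuantumRelation N W → φ.pullback (intrinsic N W) ∈ intrinsicStructure M 𝒱 →
    intrinsic N W ∈ intrinsicStructure N 𝒰

variable {𝒱 : Set (Submodule ℂ (H →L[ℂ] H))} {𝒰 : Set (Submodule ℂ (K →L[ℂ] K))}

theorem IsExpanding.expandsQuantumRelations {φ : QuantumFunction M N} (h : φ.IsExpanding 𝒱 𝒰) :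
    φ.ExpandsQuantumRelations 𝒱 𝒰 :=
  fun W _ hW => h _ (isIntrinsicQuantumRelation_intrinsic N W) hW

/-- The image of a uniformly bounded family under an expanding quantum function is uniformly
bounded. -/
theorem isUniformlyBounded_imageSet (h𝒱 : IsQuantumCoarseStructure M 𝒱) {φ : QuantumFunction M N}
    (hφ : φ.ExpandsQuantumRelations 𝒱 𝒰) {P : Set (H →L[ℂ] H)} (hP : P ⊆ projections M)
    (hb : IsUniformlyBounded M 𝒱 P) : IsUniformlyBounded N 𝒰 (φ.imageSet P) := by
  obtain ⟨_, ⟨V, hV, rfl⟩, hdiam⟩ := hb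
  obtain ⟨z, hzp, hz1, hz⟩ := φ.exists_support
  refine ⟨_, hφ (weakStarSpan (sandwich ((fun y => (y, y)) '' φ.imageSet P))) ?_ ?_, ?_⟩
  · refine isQuantumRelation_sandwich ?_
    rintro _ ⟨y, hy, rfl⟩
    exact ⟨(φ.imageSet_subset hP hy).1, (φ.imageSet_subset hP hy).1⟩
  · rw [pullback_intrinsic_sandwich hzp hz1 hz hP]
    refine ⟨_, h𝒱.mem_of_le V hV _ (isQuantumRelation_sandwich ?_) ?_, rfl⟩
    · rintro _ ⟨r, hr, rfl⟩
      exact ⟨mul_mem (hP hr).1 z.2, mul_mem (s := M) z.2 (hP hr).1⟩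
    · refine weakStarSpan_le (h𝒱.isQuantumRelation V hV).isClosed ?_
      rintro _ ⟨_, ⟨r, hr, rfl⟩, a, rfl⟩
      -- Here `r z a z r = r (z a z) r`, so the diameter bound, applied to the middle operator `z a
      -- z`, puts every pair detected by it into `R_V`.
      refine mem_of_intrinsic (h𝒱.isQuantumRelation V hV) fun p hp q hq hne => ?_
      refine hdiam r hr p hp q hq ⟨(z : H →L[ℂ] H) * a * (z : H →L[ℂ] H), ?_⟩
      simpa only [mul_assoc] using hne
  · intro y hy r hr s hs ⟨a, ha⟩
    exact ⟨hr, hs, _, subset_weakStarSpan _ ⟨_, ⟨y, hy, rfl⟩, a, rfl⟩, ha⟩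

/-- Coarseness supplies the scale `φ*(R)` at which `M` is covered; expansion controls the size of
the image cover. -/
theorem asydimLE_of_isCoarse (h𝒱 : IsQuantumCoarseStructure M 𝒱) {φ : QuantumFunction M N}
    (hc : φ.IsCoarse 𝒱 𝒰) (he : φ.ExpandsQuantumRelations 𝒱 𝒰) {n : ℕ} (h : AsydimLE M 𝒱 n) :
    AsydimLE N 𝒰 n := by
  intro R hR
  obtain ⟨P, hP, hsup, hdisj, hb⟩ := h _ (hc R hR)
  refine ⟨fun i => φ.imageSet (P i), fun i => φ.imageSet_subset (hP i), ?_, fun i => ?_,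
    fun i => isUniformlyBounded_imageSet h𝒱 he (hP i) (hb i)⟩
  · rw [← imageSet_iUnion]
    exact φ.projSup_imageSet (Set.iUnion_subset hP) hsup
  · rintro _ ⟨p, hp, rfl⟩ _ ⟨q, hq, rfl⟩ hpq hmem
    -- Distinct images have distinct preimages, so disjointness of `P i` applies even if `φ` is not
    -- injective.
    refine hdisj i p hp q hq (fun h => hpq (by rw [Subtype.ext h])) ?_
    refine ⟨tensorOne_mem_projections (hP i hp), tensorOne_mem_projections (hP i hq), ?_⟩
    rw [amplify_tensorOne, amplify_tensorOne]
    exact hmem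

theorem asydim_le_of_isCoarse (h𝒱 : IsQuantumCoarseStructure M 𝒱) {φ : QuantumFunction M N}
    (hc : φ.IsCoarse 𝒱 𝒰) (he : φ.ExpandsQuantumRelations 𝒱 𝒰) : asydim N 𝒰 ≤ asydim M 𝒱 := by
  refine sInf_le_sInf ?_
  rintro _ ⟨n, rfl, h⟩
  exact ⟨n, rfl, asydimLE_of_isCoarse h𝒱 hc he h⟩

/-! ### Coarse equivalences expand quantum relations -/

/-- The join of the projections `[(c ⊗ 1) p]`, `c ∈ U`, belongs to `M ⊗̄ B(ℓ²)`. -/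
theorem projSup_tensorOne_mul_mem {U : Submodule ℂ (H →L[ℂ] H)} (hU : IsQuantumRelation M U)
    (p : Ell2 H →L[ℂ] Ell2 H) :
    projSup ((fun c => tensorOne c * p) '' (U : Set (H →L[ℂ] H))) ∈ projections (ampAlg M) := by
  refine starProjection_mem_ampAlg fun s hs =>
    mem_topologicalClosure_of_forall (Submodule.isClosed_topologicalClosure _) fun ξ hξ =>
      Submodule.le_topologicalClosure _ ?_
  have : (⨆ x ∈ (fun c => tensorOne c * p) '' (U : Set (H →L[ℂ] H)), x.range) ≤
      (⨆ x ∈ (fun c => tensorOne c * p) '' (U : Set (H →L[ℂ] H)), x.range).comap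
        (tensorOne s : Ell2 H →ₗ[ℂ] Ell2 H) := by
    refine iSup₂_le ?_
    rintro _ ⟨c, hc, rfl⟩ _ ⟨η, rfl⟩
    exact Submodule.mem_iSup_of_mem _ (Submodule.mem_iSup_of_mem
      ⟨s * c, hU.left_mem s hs c hc, rfl⟩ ⟨η, rfl⟩)
  exact this hξ

/-- If `θ` is close to the identity along `U`, then `p ≤ (θ ⊗ 1)(⋁ [(c ⊗ 1) p])`, where `c` ranges
over `U`. -/
theorem amplify_projSup_mul {θ : QuantumFunction M M} {U : Submodule ℂ (H →L[ℂ] H)}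
    (hU : IsQuantumRelation M U)
    (hθ : ∀ (p q : Ell2 H →L[ℂ] Ell2 H) (hp : p ∈ projections (ampAlg M))
      (hq : q ∈ projections (ampAlg M)),
      amplify θ.toHom ⟨p, hp.1⟩ * amplify (id M).toHom ⟨q, hq.1⟩ ≠ 0 → (p, q) ∈ intrinsic M U)
    {p : Ell2 H →L[ℂ] Ell2 H} (hp : p ∈ projections (ampAlg M)) :
    amplify θ.toHom ⟨_, (projSup_tensorOne_mul_mem hU p).1⟩ * p = p := by
  set p' := projSup ((fun c => tensorOne c * p) '' (U : Set (H →L[ℂ] H))) with hp'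
  have hp'm : p' ∈ projections (ampAlg M) := projSup_tensorOne_mul_mem hU p
  have h1m : 1 - p' ∈ projections (ampAlg M) :=
    ⟨sub_mem (one_mem _) hp'm.1, hp'm.2.one_sub⟩
  by_contra hne
  -- If `(θ ⊗ 1)(1 - p') p ≠ 0`, closeness gives `c ∈ U` with `(1 - p')(c ⊗ 1) p ≠ 0`, but `p'`
  -- dominates the range of `(c ⊗ 1) p`.
  obtain ⟨-, -, c, hc, h⟩ := hθ (1 - p') p h1m hp (by
    intro h0
    apply hne
    have h2 : amplify (id M).toHom ⟨p, hp.1⟩ = p := amplify_id _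
    rw [h2, amplify_sub _ (one_mem _) hp'm.1, amplify_one, sub_mul, one_mul, sub_eq_zero] at h0
    exact h0.symm)
  apply h
  change (1 - p') * tensorOne c * p = 0
  rw [mul_assoc, sub_mul, one_mul, hp',
    projSup_mul (Set.mem_image_of_mem (fun c => tensorOne c * p) hc), sub_self]

/-- A quantum coarse equivalence expands quantum relations. -/
theorem expandsQuantumRelations_of_close (h𝒰 : IsQuantumCoarseStructure N 𝒰)
    {φ : QuantumFunction M N} {ψ : QuantumFunction N M} (hψ : ψ.IsCoarse 𝒰 𝒱)
    (hcl : IsClose 𝒰 (φ.comp ψ) (id N)) : φ.ExpandsQuantumRelations 𝒱 𝒰 := by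
  intro W hW hpull
  obtain ⟨_, ⟨U₀, hU₀, rfl⟩, hθ⟩ := hcl
  obtain ⟨U₁, hU₁, hU₁eq⟩ := hψ _ hpull
  have hU₀q := h𝒰.isQuantumRelation U₀ hU₀
  let A : Submodule ℂ (K →L[ℂ] K) :=
    weakStarSpan {x | ∃ a ∈ adjointSpace U₀, ∃ b ∈ U₁, x = a * b}
  -- The weak*-closed product `U₀* U₁ U₀`: one factor `U₀` for the displacement of each argument
  -- under `φ ∘ ψ`.
  let B : Submodule ℂ (K →L[ℂ] K) := weakStarSpan {x | ∃ a ∈ A, ∃ b ∈ U₀, x = a * b}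
  have hB : B ∈ 𝒰 := h𝒰.mul_mem _ (h𝒰.mul_mem _ (h𝒰.adjoint_mem _ hU₀) _ hU₁) _ hU₀
  refine ⟨W, h𝒰.mem_of_le B hB W hW fun w hw => ?_, rfl⟩
  refine mem_of_intrinsic (h𝒰.isQuantumRelation B hB) fun p hp q hq hne => ?_
  by_contra hnot
  have hpq : ∀ b ∈ B, p * tensorOne b * q = 0 := fun b hb => by
    by_contra h
    exact hnot ⟨hp, hq, b, hb, h⟩
  -- The `U₀`-neighbourhoods of `p` and `q`, whose images under `(φ ∘ ψ) ⊗ 1` dominate `p` and `q`.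
  set p' := projSup ((fun c => tensorOne c * p) '' (U₀ : Set (K →L[ℂ] K)))
  set q' := projSup ((fun c => tensorOne c * q) '' (U₀ : Set (K →L[ℂ] K)))
  have hp'm : p' ∈ projections (ampAlg N) := projSup_tensorOne_mul_mem hU₀q p
  have hq'm : q' ∈ projections (ampAlg N) := projSup_tensorOne_mul_mem hU₀q q
  have hθp := amplify_projSup_mul hU₀q hθ hp
  have hθq := amplify_projSup_mul hU₀q hθ hq
  -- On generators this is `p (d* u c ⊗ 1) q = 0` with `c, d ∈ U₀`, true because `d* u c ∈ B`. The
  -- adjoint lets the same one-sided argument treat `p'`.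
  have hp'q' : ∀ u ∈ U₁, p' * tensorOne u * q' = 0 := by
    intro u hu
    refine mul_projSup_eq_zero ?_
    rintro _ ⟨c, hc, rfl⟩
    change p' * tensorOne u * (tensorOne c * q) = 0
    rw [← star_eq_zero, mul_assoc, star_mul, hp'm.2.2.star_eq]
    refine mul_projSup_eq_zero ?_
    rintro _ ⟨d, hd, rfl⟩
    change star (tensorOne u * (tensorOne c * q)) * (tensorOne d * p) = 0
    rw [← star_eq_zero, star_mul, star_star, star_mul, hp.2.2.star_eq, star_tensorOne]
    have hmem : star d * u * c ∈ B := subset_weakStarSpan _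
      ⟨star d * u, subset_weakStarSpan _ ⟨star d, by
        change star (star d) ∈ U₀
        rwa [star_star], u, hu, rfl⟩, c, hc, rfl⟩
    have := hpq _ hmem
    rw [tensorOne_mul, tensorOne_mul] at this
    simpa only [mul_assoc] using this
  have hnotmem : (p', q') ∉ intrinsic N U₁ := fun h => by
    obtain ⟨-, -, u, hu, h⟩ := h
    exact h (hp'q' u hu)
  apply hnotmem
  -- The contradiction: `R_{U₁}` is the pullback of `R_W` along `φ ∘ ψ`, and compressing to `p` and
  -- `q` recovers `p (w ⊗ 1) q ≠ 0`.
  rw [hU₁eq]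
  refine ⟨hp'm, hq'm, ψ.amplify_mem_projections hp'm, ψ.amplify_mem_projections hq'm, ?_⟩
  rw [amplify_amplify, amplify_amplify]
  refine ⟨(φ.comp ψ).amplify_mem_projections hp'm, (φ.comp ψ).amplify_mem_projections hq'm, w, hw,
    fun h0 => hne ?_⟩
  change amplify (φ.comp ψ).toHom ⟨p', hp'm.1⟩ * tensorOne w *
    amplify (φ.comp ψ).toHom ⟨q', hq'm.1⟩ = 0 at h0
  have h1 : p * amplify (φ.comp ψ).toHom ⟨p', hp'm.1⟩ = p := by
    have := congrArg star hθp
    rwa [star_mul, hp.2.2.star_eq, ((φ.comp ψ).amplify_mem_projections hp'm).2.2.star_eq] at this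
  have h2 : p * tensorOne w * q = p * (amplify (φ.comp ψ).toHom ⟨p', hp'm.1⟩ * tensorOne w *
      amplify (φ.comp ψ).toHom ⟨q', hq'm.1⟩) * q := by
    conv_lhs => rw [← h1, ← hθq]
    simp only [mul_assoc]
    rfl
  rw [h2, h0, mul_zero, zero_mul]

end QuantumFunction

end QuantumCoarse

theorem theorem7p28 {H K : Type*}
    [NormedAddCommGroup H] [InnerProductSpace ℂ H] [CompleteSpace H]
    [NormedAddCommGroup K] [InnerProductSpace ℂ K] [CompleteSpace K]
    (M : VonNeumannAlgebra H) (N : VonNeumannAlgebra K)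
    (𝒱 : Set (Submodule ℂ (H →L[ℂ] H))) (𝒰 : Set (Submodule ℂ (K →L[ℂ] K)))
    (h𝒱 : QuantumCoarse.IsQuantumCoarseStructure M 𝒱)
    (h𝒰 : QuantumCoarse.IsQuantumCoarseStructure N 𝒰) :
    ((∃ φ : QuantumCoarse.QuantumFunction M N, φ.IsCoarse 𝒱 𝒰 ∧ φ.IsExpanding 𝒱 𝒰) →
      QuantumCoarse.asydim N 𝒰 ≤ QuantumCoarse.asydim M 𝒱) ∧
    (QuantumCoarse.CoarselyEquivalent M 𝒱 N 𝒰 →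
      QuantumCoarse.asydim N 𝒰 = QuantumCoarse.asydim M 𝒱) := by
  refine ⟨fun ⟨φ, hc, he⟩ => φ.asydim_le_of_isCoarse h𝒱 hc he.expandsQuantumRelations, ?_⟩
  rintro ⟨φ, hφ, ψ, hψ, hψφ, hφψ⟩
  -- Each inequality uses one of the two closeness relations, with the roles of `φ` and `ψ`
  -- exchanged.
  exact le_antisymm
    (φ.asydim_le_of_isCoarse h𝒱 hφ
      (QuantumCoarse.QuantumFunction.expandsQuantumRelations_of_close h𝒰 hψ hφψ))
    (ψ.asydim_le_of_isCoarse h𝒰 hψ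
      (QuantumCoarse.QuantumFunction.expandsQuantumRelations_of_close h𝒱 hφ hψφ))
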